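/- Write $e(\theta)=e^{2\pi i\theta}$ and let $d_k$ be the $k$-fold divisor function. **Definition.** For an integer $k\ge 1$ and a real number $\alpha\ge 0$, the class $\mathcal F_k(\alpha)$ consists of the multiplicative functions $f\colon\mathbb N\to\mathbb C$ such that: 1. $|f(n)|\le d_k(n)$ for all $n$. 2. For every $q\ge 1$ and every Dirichlet character $\chi$ modulo $q$, the series $L(f,\chi,s)=\sum_{n\ge1} f(n)\chi(n)n^{-s}$ ($\Re s>1$) has an analytic continuation to $\Re s>1/2$, holomorphic except for at most a simple pole at $s=1$, which can occur only if $\chi$ is principal. It has no zero with $\Re s\ge 1$. It extends continuously to the line $\Re s=1/2$ and is of finite order: $|L(f,\chi,s)|\le B\exp(|\Im s|^{A})$ for $\Re s\ge 1/2$, $|\Im s|\ge1$, with some $A,B$ that may depend on $f$ and $\chi$. 3. For every $\varepsilon>0$ there is a constant $C$ (depending only on $f,\alpha,\varepsilon$) such that for all $q\ge 1$, all $\chi$ modulo $q$ and all real $T\ge1$, $$\int_{-T}^{T}\left|L(f,\chi,1/2+it)\right|^2dt\le C\,q^{\varepsilon^2}(1+T)^{1+\alpha+\varepsilon^2}.$$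 **Theorem.** Let $k\ge1$, $\varepsilon>0$ and $g\colon\mathbb N\to\mathbb C$. (a) Let $0\le\alpha<1$ and $g\in\mathcal F_k(\alpha)$. There are constants $C,K>0$, depending only on $g,k,\alpha,\varepsilon$, such that for all $0<\eta<1$, all integers $0\le a<q$, all real $X>q$, $x\in[X,2X]$, $1\le H\le X$ and $|\gamma|<1$ with $|\gamma|H^{\eta-\varepsilon/2}\ge K$, $$\Bigl|\sum_{x\le m\le x+H}g(m)\,e\bigl(m(\tfrac aq+\gamma)\bigr)\Bigr|\le C\Bigl((q|\gamma|X)^{(1+\alpha)/2+\varepsilon^2}H^{1/2}+\sum_{x-H^\eta\le m\le x}d_k(m)+\sum_{x+H\le m\le x+H+H^\eta}d_k(m)\Bigr).$$ (b) Let $g\in\mathcal F_k(0)$. There are constants $C,K>0$, depending only on $g,k,\varepsilon$, such that under the same conditions on $\eta,a,q,X,x,H,\gamma$, $$\Bigl|\sum_{x\le m\le x+H}g(m)\,e\bigl(m(\tfrac aq+\gamma)\bigr)\Bigr|\le C\Bigl((q|\gamma|X)^{1/2+\varepsilon^2}H^{1/2}+H^\eta(\log X)^{k^2-1}\Bigr).$$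 -/

import Mathlib

/-- `e(θ) = exp(2πiθ)`. -/
noncomputable def expE (θ : ℝ) : ℂ :=
  Complex.exp (2 * (Real.pi : ℂ) * Complex.I * (θ : ℂ))

/-- The `k`-fold divisor function `d_k`: the `k`-fold Dirichlet convolution `1 * ⋯ * 1`. -/
def divisorK (k : ℕ) : ArithmeticFunction ℕ :=
  ArithmeticFunction.zeta ^ k

/-- `Λ` is the analytic continuation of `L(f, χ, s) = ∑ f(n) χ(n) n^{-s}` to `Re s > 1/2`, with
boundary values on `Re s = 1/2`: it is holomorphic for `Re s > 1/2` except for at most a simple pole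
at `s = 1`, which occurs only for principal `χ`; it is continuous up to the line `Re s = 1/2`, of
finite order, and has no zero with `Re s ≥ 1`. The condition at the point `s = 1` itself is stated
through the order of the Laurent expansion, so that the value `Λ 1` plays no role. -/
structure IsLContinuation (f : ArithmeticFunction ℂ) {q : ℕ} (χ : DirichletCharacter ℂ q)
    (Λ : ℂ → ℂ) : Prop where
  eq_LSeries : ∀ s : ℂ, 1 < s.re → Λ s = LSeries (fun n : ℕ => f n * χ (n : ZMod q)) s
  holomorphic : DifferentiableOn ℂ Λ ({s : ℂ | 1 / 2 < s.re} \ {1})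
  continuous_boundary : ContinuousOn Λ ({s : ℂ | 1 / 2 ≤ s.re} \ {1})
  meromorphic_one : MeromorphicAt Λ 1
  order_one_principal : χ = 1 → -1 ≤ meromorphicOrderAt Λ 1
  order_one_nonprincipal : χ ≠ 1 → 0 ≤ meromorphicOrderAt Λ 1
  ne_zero : ∀ s : ℂ, 1 ≤ s.re → s ≠ 1 → Λ s ≠ 0
  ne_zero_one : meromorphicOrderAt Λ 1 ≤ 0
  finite_order : ∃ A B : ℝ, ∀ s : ℂ, 1 / 2 ≤ s.re → 1 ≤ |s.im| →
    ‖Λ s‖ ≤ B * Real.exp (|s.im| ^ A)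

/-- The class `F_k(α)` of multiplicative functions `f : ℕ → ℂ` with `|f(n)| ≤ d_k(n)`, whose
`L`-functions `L(f, χ, s)` have the analytic continuation above for every Dirichlet character `χ`,
and satisfy the second moment estimate on the line `Re s = 1/2`, uniformly in `q`, `χ` and `T`. -/
structure ClassF (k : ℕ) (α : ℝ) (f : ArithmeticFunction ℂ) : Prop where
  multiplicative : f.IsMultiplicative
  divisor_bound : ∀ n : ℕ, ‖f n‖ ≤ (divisorK k n : ℝ)
  analytic : ∃ Λ : (q : ℕ) → DirichletCharacter ℂ q → ℂ → ℂ,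
    (∀ q : ℕ, 0 < q → ∀ χ : DirichletCharacter ℂ q, IsLContinuation f χ (Λ q χ)) ∧
    (∀ ε : ℝ, 0 < ε → ∃ C : ℝ, ∀ q : ℕ, 0 < q → ∀ χ : DirichletCharacter ℂ q, ∀ T : ℝ, 1 ≤ T →
      ∫ t in (-T)..T, ‖Λ q χ (1 / 2 + (t : ℂ) * Complex.I)‖ ^ 2
        ≤ C * (q : ℝ) ^ (ε ^ 2) * (1 + T) ^ (1 + α + ε ^ 2))

/-- `∑_{x ≤ m ≤ x + H} g(m) e(mθ)`. -/
noncomputable def shortExpSum (g : ArithmeticFunction ℂ) (x H θ : ℝ) : ℂ :=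
  ∑ m ∈ Finset.Icc ⌈x⌉₊ ⌊x + H⌋₊, g m * expE ((m : ℝ) * θ)

/-- `∑_{u ≤ m ≤ v} d_k(m)`, over positive integers `m`. -/
noncomputable def divisorSum (k : ℕ) (u v : ℝ) : ℝ :=
  ∑ m ∈ Finset.Icc ⌈u⌉₊ ⌊v⌋₊, (divisorK k m : ℝ)

/-! The sharp cutoff is replaced by a smooth weight `W`, equal to e(γu) on [x, x+H], supported
within 1/|γ| of that interval, with |W| ≪ 1 and |W'| ≪ |γ|. Smoothing at the scale 1/|γ| is free,
since e(γu) already oscillates at that scale. `W` is moreover the derivative of a compactly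
supported function, so its Mellin transform vanishes at s = 1 and kills the possible pole there
(`exists_smooth_weight`).

Each m ≥ 1 is uniquely dn with d composed of primes dividing q and n coprime to q. For such n,
e(dna/q) is a combination of characters modulo q whose coefficients have absolute sum at most √q, by
Parseval (`exists_dirichletCharacter_expansion`). Mellin inversion and a shift to Re s = 1/2 bound ∑
g(n)χ(n)W(dn) by d^(-1/2) times the integral of |L| |mellin W| on that line
(`IsLContinuation.norm_tsum_mul_test_le`). Put T = |γ|X and apply Cauchy–Schwarz with the weight T²
+ t². The moment hypothesis gives ∫ |L|²/(T² + t²) ≪ q^(ε²) T^(α-1+ε²), and Plancherel for `W` and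
for its derivative gives ∫ (T² + t²)|mellin W|² ≪ T²H. The product of the square roots is q^(ε²/2)
T^((1+α+ε²)/2) H^(1/2). Since g(d) ≪ d^(1/4), the sum over d costs only a small power of q.

The smooth and sharp sums differ only on two edges of length 1/|γ| ≤ H^(η-ε/2)/2, which gives (a).
For (b) the pointwise bound d_k(m) ≪ m^δ suffices on the edges: if H ≥ X^(1/3), the room H^(ε/2)
absorbs X^δ; if H is smaller, the edges contribute at most X^(1/2), which the main term dominates
(`exists_rpow_edge_le`). -/

/-! ### Divisor bounds, and sums over integers composed of primes dividing q. -/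

theorem two_pow_card_primeFactors_le_card_divisors {n : ℕ} (hn : n ≠ 0) :
    2 ^ n.primeFactors.card ≤ n.divisors.card := by
  rw [Nat.card_divisors hn, ← Finset.prod_const]
  refine Finset.prod_le_prod' fun p hp => ?_
  have := (Nat.prime_of_mem_primeFactors hp).factorization_pos_of_dvd hn
    (Nat.dvd_of_mem_primeFactors hp)
  lia

/-- Compare the factors v + 1 of d(n) with the factors p^(δv) of n^δ. Once p ≥ 2^(1/δ) one has
p^(δv) ≥ 2^v ≥ v + 1; each of the finitely many smaller primes loses at most a constant factor. -/
theorem exists_card_divisors_le_rpow {δ : ℝ} (hδ : 0 < δ) :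
    ∃ C : ℝ, 0 < C ∧ ∀ n : ℕ, (n.divisors.card : ℝ) ≤ C * (n : ℝ) ^ δ := by
  set c : ℝ := δ * Real.log 2 with hc
  have hc0 : 0 < c := mul_pos hδ (Real.log_pos one_lt_two)
  -- Chosen so that A(1 + cv) ≥ 1 + v, where 2^(δv) ≥ 1 + cv.
  set A : ℝ := 1 + 1 / c with hA
  have hA1 : 1 ≤ A := by rw [hA]; have : 0 < 1 / c := by positivity
                         linarith
  set P : ℕ := ⌈(2 : ℝ) ^ (1 / δ)⌉₊ with hP
  refine ⟨A ^ P, by positivity, fun n => ?_⟩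
  rcases eq_or_ne n 0 with rfl | hn
  · simp; positivity
  have hsmall : ∀ p : ℕ, p.Prime → ∀ v : ℕ, (v : ℝ) + 1 ≤ A * ((p : ℝ) ^ δ) ^ v := by
    intro p hp v
    have h2 : (2 : ℝ) ≤ p := by exact_mod_cast hp.two_le
    have h3 : 1 + c * v ≤ ((2 : ℝ) ^ δ) ^ v := by
      rw [← Real.rpow_natCast, ← Real.rpow_mul (by norm_num), Real.rpow_def_of_pos two_pos]
      have := Real.add_one_le_exp (Real.log 2 * (δ * v))
      rw [hc]; linarith
    have h4 : ((2 : ℝ) ^ δ) ^ v ≤ ((p : ℝ) ^ δ) ^ v :=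
      pow_le_pow_left₀ (by positivity) (Real.rpow_le_rpow (by norm_num) h2 hδ.le) v
    have h5 : (v : ℝ) + 1 ≤ A * (1 + c * v) := by
      have : A * (1 + c * v) = 1 + v + (c * v + 1 / c) := by
        rw [hA]; field_simp; ring
      rw [this]
      have : 0 ≤ c * v + 1 / c := by positivity
      linarith
    calc (v : ℝ) + 1 ≤ A * (1 + c * v) := h5
      _ ≤ A * ((p : ℝ) ^ δ) ^ v := by gcongr; exact h3.trans h4
  have hlarge : ∀ p : ℕ, P ≤ p → ∀ v : ℕ, (v : ℝ) + 1 ≤ ((p : ℝ) ^ δ) ^ v := by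
    intro p hp v
    have h1 : (2 : ℝ) ^ (1 / δ) ≤ p := (Nat.le_ceil _).trans (by exact_mod_cast hp)
    have h2 : (2 : ℝ) ≤ (p : ℝ) ^ δ := by
      calc (2 : ℝ) = ((2 : ℝ) ^ (1 / δ)) ^ δ := by
            rw [← Real.rpow_mul (by norm_num), one_div_mul_cancel hδ.ne', Real.rpow_one]
        _ ≤ _ := Real.rpow_le_rpow (by positivity) h1 hδ.le
    calc (v : ℝ) + 1 ≤ 2 ^ v := by exact_mod_cast Nat.lt_two_pow_self
      _ ≤ _ := pow_le_pow_left₀ (by norm_num) h2 v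
  have hprod : (n : ℝ) ^ δ = ∏ p ∈ n.primeFactors, ((p : ℝ) ^ δ) ^ (n.factorization p) := by
    conv_lhs => rw [← Nat.prod_factorization_pow_eq_self hn, Finsupp.prod, Nat.cast_prod]
    rw [← Real.finsetProd_rpow _ _ (fun i _ => by positivity)]
    refine Finset.prod_congr rfl fun p _ => ?_
    rw [Nat.cast_pow, ← Real.rpow_natCast, ← Real.rpow_natCast, ← Real.rpow_mul (by positivity),
      ← Real.rpow_mul (by positivity), mul_comm]
  rw [Nat.card_divisors hn, hprod]
  push_cast
  calc ∏ p ∈ n.primeFactors, ((n.factorization p : ℝ) + 1)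
      ≤ ∏ p ∈ n.primeFactors, ((if p < P then A else 1) * ((p : ℝ) ^ δ) ^ (n.factorization p)) := by
        refine Finset.prod_le_prod (fun _ _ => by positivity) fun p hp => ?_
        split_ifs with h
        · exact hsmall p (Nat.prime_of_mem_primeFactors hp) _
        · rw [one_mul]; exact hlarge p (not_lt.mp h) _
    _ = (∏ p ∈ n.primeFactors, (if p < P then A else 1)) *
          ∏ p ∈ n.primeFactors, ((p : ℝ) ^ δ) ^ (n.factorization p) := Finset.prod_mul_distrib
    _ ≤ _ := by
        refine mul_le_mul_of_nonneg_right ?_ (Finset.prod_nonneg fun _ _ => by positivity)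
        rw [← Finset.prod_filter, Finset.prod_const]
        refine pow_le_pow_right₀ hA1 ?_
        calc _ ≤ (Finset.range P).card := Finset.card_le_card fun p hp => by
              simp only [Finset.mem_filter] at hp
              simpa using hp.2
          _ = P := Finset.card_range P

theorem exists_divisorK_le_rpow (k : ℕ) : ∀ {δ : ℝ}, 0 < δ →
    ∃ C : ℝ, 0 < C ∧ ∀ n : ℕ, (divisorK k n : ℝ) ≤ C * (n : ℝ) ^ δ := by
  induction k with
  | zero =>
    intro δ hδ
    refine ⟨1, one_pos, fun n => ?_⟩
    rw [divisorK, pow_zero, ArithmeticFunction.one_apply]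
    split_ifs with h
    · simp [h]
    · simp; positivity
  | succ k ih =>
    intro δ hδ
    obtain ⟨C₁, hC₁, h₁⟩ := ih (half_pos hδ)
    obtain ⟨C₂, hC₂, h₂⟩ := exists_card_divisors_le_rpow (half_pos hδ)
    refine ⟨C₂ * C₁, mul_pos hC₂ hC₁, fun n => ?_⟩
    rcases eq_or_ne n 0 with rfl | hn
    · simp; positivity
    have hn0 : (0 : ℝ) < n := by exact_mod_cast Nat.pos_of_ne_zero hn
    have : divisorK (k + 1) n = ∑ d ∈ n.divisors, divisorK k d := by
      rw [divisorK, pow_succ, ← ArithmeticFunction.coe_mul_zeta_apply]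
      simp [divisorK]
    rw [this]
    push_cast
    calc ∑ d ∈ n.divisors, (divisorK k d : ℝ) ≤ ∑ d ∈ n.divisors, C₁ * (n : ℝ) ^ (δ / 2) := by
          refine Finset.sum_le_sum fun d hd => (h₁ d).trans ?_
          gcongr
          exact Nat.divisor_le hd
      _ = n.divisors.card * (C₁ * (n : ℝ) ^ (δ / 2)) := by rw [Finset.sum_const, nsmul_eq_mul]
      _ ≤ (C₂ * (n : ℝ) ^ (δ / 2)) * (C₁ * (n : ℝ) ^ (δ / 2)) := by gcongr; exact h₂ n
      _ = C₂ * C₁ * ((n : ℝ) ^ (δ / 2) * (n : ℝ) ^ (δ / 2)) := by ring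
      _ = _ := by rw [← Real.rpow_add hn0, add_halves]

/-- The full sum is the Euler product of (1 - p^(-β))⁻¹ over p | q. Each factor is at most a fixed
power 2^(j+1), so the product is at most (2^ω(q))^(j+1) ≤ d(q)^(j+1), and the divisor bound applies.
-/
theorem exists_sum_factoredNumbers_rpow_le {β δ : ℝ} (hβ : 0 < β) (hδ : 0 < δ) :
    ∃ C : ℝ, 0 < C ∧ ∀ q : ℕ, q ≠ 0 → ∀ D : Finset ℕ,
      (∀ d ∈ D, d ∈ Nat.factoredNumbers q.primeFactors) →
        ∑ d ∈ D, (d : ℝ) ^ (-β) ≤ C * (q : ℝ) ^ δ := by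
  have hb : (2 : ℝ) ^ (-β) < 1 := Real.rpow_lt_one_of_one_lt_of_neg one_lt_two (neg_lt_zero.mpr hβ)
  obtain ⟨j, hj⟩ := pow_unbounded_of_one_lt ((1 - (2 : ℝ) ^ (-β))⁻¹) (one_lt_two (α := ℝ))
  have hj' : (1 - (2 : ℝ) ^ (-β))⁻¹ ≤ 2 ^ (j + 1) :=
    hj.le.trans (pow_le_pow_right₀ one_le_two (Nat.le_succ j))
  have hδj : 0 < δ / (j + 1 : ℕ) := by positivity
  obtain ⟨C, hC, hCn⟩ := exists_card_divisors_le_rpow hδj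
  refine ⟨C ^ (j + 1), by positivity, fun q hq D hD => ?_⟩
  let f : ℕ →* ℝ :=
    { toFun := fun n => (n : ℝ) ^ (-β)
      map_one' := by simp
      map_mul' := fun a b => by
        simp only [Nat.cast_mul]
        exact Real.mul_rpow (by positivity) (by positivity) }
  have hfp : ∀ p : ℕ, p.Prime → f p ≤ (2 : ℝ) ^ (-β) := fun p hp =>
    Real.rpow_le_rpow_of_nonpos two_pos (by exact_mod_cast hp.two_le) (neg_nonpos.mpr hβ.le)
  have hf0 : ∀ n, 0 ≤ f n := fun n => Real.rpow_nonneg (by positivity) _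
  obtain ⟨-, hs⟩ := EulerProduct.summable_and_hasSum_factoredNumbers_prod_filter_prime_geometric
    (f := f) (fun {p} hp => by
      rw [Real.norm_of_nonneg (hf0 p)]; exact (hfp p hp).trans_lt hb) q.primeFactors
  have h1 : ∑ d ∈ D, (d : ℝ) ^ (-β) ≤ ∏ p ∈ q.primeFactors with p.Prime, (1 - f p)⁻¹ := by
    have := sum_le_hasSum (D.subtype (· ∈ Nat.factoredNumbers q.primeFactors))
      (fun i _ => hf0 i) hs
    rwa [Finset.sum_subtype_of_mem (fun d => f d) hD] at this
  calc ∑ d ∈ D, (d : ℝ) ^ (-β) ≤ ∏ p ∈ q.primeFactors with p.Prime, (1 - f p)⁻¹ := h1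
    _ ≤ ∏ p ∈ q.primeFactors with p.Prime, (2 : ℝ) ^ (j + 1) := by
        refine Finset.prod_le_prod (fun p hp => ?_) fun p hp => ?_
        · have := (hfp p (Finset.mem_filter.mp hp).2).trans_lt hb
          exact inv_nonneg.mpr (by linarith)
        · refine le_trans ?_ hj'
          have := hfp p (Finset.mem_filter.mp hp).2
          exact inv_anti₀ (by linarith) (by linarith)
    _ = ((2 : ℝ) ^ q.primeFactors.card) ^ (j + 1) := by
        rw [Finset.prod_const, Finset.filter_true_of_mem fun p hp => Nat.prime_of_mem_primeFactors hp,
          ← pow_mul, ← pow_mul, mul_comm]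
    _ ≤ (C * (q : ℝ) ^ (δ / (j + 1 : ℕ))) ^ (j + 1) := by
        refine pow_le_pow_left₀ (by positivity) (le_trans ?_ (hCn q)) _
        exact_mod_cast two_pow_card_primeFactors_le_card_divisors hq
    _ = C ^ (j + 1) * (q : ℝ) ^ δ := by
        rw [mul_pow, ← Real.rpow_natCast (n := j + 1) ((q : ℝ) ^ _), ← Real.rpow_mul (by positivity),
          div_mul_cancel₀ _ (by positivity)]

/-! ### Expansion in Dirichlet characters and the factorization m = dn. -/

theorem DirichletCharacter.apply_units_inv {q : ℕ} (χ : DirichletCharacter ℂ q) (b : (ZMod q)ˣ) :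
    χ ((b : ZMod q)⁻¹) = (starRingEnd ℂ) (χ b) := by
  rw [ZMod.inv_coe_unit, ← Complex.inv_eq_conj (χ.unit_norm_eq_one b)]
  refine eq_inv_of_mul_eq_one_left ?_
  rw [← map_mul]; simp

/-- Fourier analysis on the unit group. Orthogonality gives ∑ |c χ|² = φ(q)⁻¹ ∑ |F b|² ≤ 1, and
Cauchy–Schwarz over the φ(q) ≤ q characters turns this into the ℓ¹ bound. -/
theorem exists_dirichletCharacter_expansion {q : ℕ} [NeZero q] (F : ZMod q → ℂ)
    (hF : ∀ b, ‖F b‖ ≤ 1) :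
    ∃ c : DirichletCharacter ℂ q → ℂ, ∑ χ, ‖c χ‖ ≤ √q ∧
      ∀ b : ZMod q, IsUnit b → F b = ∑ χ, c χ * χ b := by
  have hφ : (q.totient : ℂ) ≠ 0 := by
    exact_mod_cast (Nat.totient_pos.mpr (Nat.pos_of_ne_zero (NeZero.ne q))).ne'
  have hφ' : (0 : ℝ) < q.totient := by
    exact_mod_cast (Nat.totient_pos.mpr (Nat.pos_of_ne_zero (NeZero.ne q)))
  have horth : ∀ (b : (ZMod q)ˣ) (b' : ZMod q), ∑ χ : DirichletCharacter ℂ q,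
      χ ((b : ZMod q)⁻¹) * χ b' = if (b : ZMod q) = b' then (q.totient : ℂ) else 0 :=
    fun b b' => DirichletCharacter.sum_char_inv_mul_char_eq ℂ b.isUnit b'
  let c : DirichletCharacter ℂ q → ℂ := fun χ =>
    (q.totient : ℂ)⁻¹ * ∑ b : (ZMod q)ˣ, F b * χ ((b : ZMod q)⁻¹)
  have hsq : ∑ χ, ‖c χ‖ ^ 2 ≤ 1 := by
    have h1 : ∀ χ, ((‖c χ‖ ^ 2 : ℝ) : ℂ) = ((q.totient : ℂ)⁻¹) ^ 2 *
        ∑ b : (ZMod q)ˣ, ∑ b' : (ZMod q)ˣ, F b * (starRingEnd ℂ) (F b') *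
          (χ ((b : ZMod q)⁻¹) * χ b') := by
      intro χ
      rw [Complex.ofReal_pow, ← Complex.mul_conj']
      simp only [c, map_mul, map_sum, map_inv₀, Complex.conj_natCast,
        DirichletCharacter.apply_units_inv, Complex.conj_conj]
      rw [mul_mul_mul_comm, Finset.sum_mul_sum, sq]
      congr 1
      refine Finset.sum_congr rfl fun b _ => Finset.sum_congr rfl fun b' _ => by ring
    have h2 : ((∑ χ, ‖c χ‖ ^ 2 : ℝ) : ℂ) =
        (((q.totient : ℝ)⁻¹ * ∑ b : (ZMod q)ˣ, ‖F b‖ ^ 2 : ℝ) : ℂ) := by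
      rw [Complex.ofReal_sum, Finset.sum_congr rfl fun χ _ => h1 χ, ← Finset.mul_sum,
        Finset.sum_comm]
      rw [Finset.sum_congr rfl fun b _ => Finset.sum_comm]
      simp_rw [← Finset.mul_sum, horth, Units.val_inj]
      simp only [mul_ite, mul_zero, Finset.sum_ite_eq, Finset.mem_univ, if_true]
      rw [← Finset.sum_mul]
      push_cast
      simp_rw [Complex.mul_conj']
      field_simp
    rw [Complex.ofReal_inj.mp h2]
    have h3 : ∑ b : (ZMod q)ˣ, ‖F b‖ ^ 2 ≤ q.totient := by
      calc ∑ b : (ZMod q)ˣ, ‖F b‖ ^ 2 ≤ ∑ b : (ZMod q)ˣ, (1 : ℝ) :=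
            Finset.sum_le_sum fun b _ => pow_le_one₀ (norm_nonneg _) (hF b)
        _ = q.totient := by simp [ZMod.card_units_eq_totient]
    rw [inv_mul_le_iff₀ hφ', mul_one]
    exact h3
  refine ⟨c, ?_, fun b hb => ?_⟩
  · refine Real.le_sqrt_of_sq_le ?_
    calc (∑ χ, ‖c χ‖) ^ 2 ≤ (Finset.univ : Finset (DirichletCharacter ℂ q)).card * ∑ χ, ‖c χ‖ ^ 2 :=
          sq_sum_le_card_mul_sum_sq
      _ ≤ q * 1 := by
          refine mul_le_mul ?_ hsq (Finset.sum_nonneg fun _ _ => by positivity) (by positivity)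
          rw [Finset.card_univ, ← Nat.card_eq_fintype_card,
            DirichletCharacter.card_eq_totient_of_hasEnoughRootsOfUnity]
          exact_mod_cast Nat.totient_le q
      _ = q := mul_one _
  · obtain ⟨u, rfl⟩ := hb
    simp only [c]
    simp_rw [mul_assoc, ← Finset.mul_sum, Finset.sum_mul]
    rw [Finset.sum_comm]
    simp_rw [mul_assoc, ← Finset.mul_sum, horth, Units.val_inj]
    simp only [mul_ite, mul_zero, Finset.sum_ite_eq', Finset.mem_univ, if_true]
    field_simp

theorem exists_factored_mul_coprime (q m : ℕ) (hq : q ≠ 0) (hm : m ≠ 0) :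
    ∃ d n : ℕ, d ∈ Nat.factoredNumbers q.primeFactors ∧ n.Coprime q ∧ d * n = m := by
  induction m using induction_on_primes with
  | zero => exact absurd rfl hm
  | one => exact ⟨1, 1, by simp [Nat.mem_factoredNumbers], by simp, rfl⟩
  | prime_mul p a hp ih =>
    obtain ⟨d, n, hd, hn, rfl⟩ := ih (right_ne_zero_of_mul hm)
    by_cases hpq : p ∣ q
    · refine ⟨p * d, n, Nat.mul_mem_factoredNumbers ?_ hd, hn, by ring⟩
      refine Nat.mem_factoredNumbers_of_primeFactors_subset hp.ne_zero ?_
      rw [hp.primeFactors, Finset.singleton_subset_iff, Nat.mem_primeFactors]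
      exact ⟨hp, hpq, hq⟩
    · exact ⟨d, p * n, hd, ((Nat.Prime.coprime_iff_not_dvd hp).mpr hpq).mul_left hn, by ring⟩

theorem coprime_of_mem_factoredNumbers {q d n : ℕ} (hd : d ∈ Nat.factoredNumbers q.primeFactors)
    (hn : n.Coprime q) : d.Coprime n := by
  refine Nat.coprime_of_dvd fun p hp hpd hpn => ?_
  have h := Nat.mem_factoredNumbers'.mp hd p hp hpd
  exact hp.one_lt.ne' (Nat.dvd_one.mp (hn ▸ Nat.dvd_gcd hpn (Nat.dvd_of_mem_primeFactors h)))

/-- Existence and uniqueness of m = dn make (d, n) ↦ dn injective on the box. Its products reach up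
to N², so the vanishing of `h` beyond `N` is what allows d and n to range independently. -/
theorem sum_Icc_eq_sum_factored_sum_coprime {q : ℕ} (hq : q ≠ 0) (N : ℕ) (h : ℕ → ℂ)
    (hN : ∀ m, N < m → h m = 0) :
    ∑ m ∈ Finset.Icc 1 N, h m =
      ∑ d ∈ Finset.Icc 1 N with d ∈ Nat.factoredNumbers q.primeFactors,
        ∑ n ∈ Finset.Icc 1 N with n.Coprime q, h (d * n) := by
  rw [← Finset.sum_product']
  symm
  have hext : ∑ m ∈ Finset.Icc 1 N, h m = ∑ m ∈ Finset.Icc 1 (N * N), h m := by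
    refine Finset.sum_subset (Finset.Icc_subset_Icc_right (Nat.le_mul_self N)) fun m hm hm' => ?_
    simp only [Finset.mem_Icc, not_and, not_le] at hm hm'
    exact hN m (hm' hm.1)
  rw [hext]
  refine Finset.sum_of_injOn (fun x : ℕ × ℕ => x.1 * x.2) ?_ ?_ ?_ fun _ _ => rfl
  · rintro ⟨d, n⟩ h1 ⟨d', n'⟩ h2 he
    simp only [Finset.coe_product, Set.mem_prod, Finset.mem_coe, Finset.mem_filter,
      Finset.mem_Icc] at h1 h2 he
    obtain ⟨⟨h1d, h1d'⟩, -, h1n⟩ := h1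
    obtain ⟨⟨h2d, h2d'⟩, -, h2n⟩ := h2
    have hd : d = d' := by
      refine Nat.dvd_antisymm ?_ ?_
      · exact (coprime_of_mem_factoredNumbers h1d' h2n).dvd_of_dvd_mul_right (he ▸ dvd_mul_right d n)
      · exact (coprime_of_mem_factoredNumbers h2d' h1n).dvd_of_dvd_mul_right
          (he ▸ dvd_mul_right d' n')
    subst hd
    rw [Nat.eq_of_mul_eq_mul_left h1d.1 he]
  · rintro ⟨d, n⟩ h1
    simp only [Finset.coe_product, Set.mem_prod, Finset.mem_coe, Finset.mem_filter,
      Finset.mem_Icc] at h1 ⊢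
    exact ⟨Nat.mul_pos h1.1.1.1 h1.2.1.1, Nat.mul_le_mul h1.1.1.2 h1.2.1.2⟩
  · intro m hm hm'
    by_contra hne
    have hmN : m ≤ N := not_lt.mp fun hlt => hne (hN m hlt)
    have hm1 : 1 ≤ m := (Finset.mem_Icc.mp hm).1
    obtain ⟨d, n, hd, hn, rfl⟩ := exists_factored_mul_coprime q m hq (by lia)
    refine hm' ⟨(d, n), ?_, rfl⟩
    have hd0 : 1 ≤ d := Nat.pos_of_ne_zero (left_ne_zero_of_mul (by lia : d * n ≠ 0))
    have hn0 : 1 ≤ n := Nat.pos_of_ne_zero (right_ne_zero_of_mul (by lia : d * n ≠ 0))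
    simp only [Finset.coe_product, Set.mem_prod, Finset.mem_coe, Finset.mem_filter, Finset.mem_Icc]
    exact ⟨⟨⟨hd0, (Nat.le_mul_of_pos_right d hn0).trans hmN⟩, hd⟩,
      ⟨hn0, (Nat.le_mul_of_pos_left n hd0).trans hmN⟩, hn⟩

/-! ### Mellin transforms of smooth compactly supported weights. -/

/-- `W` is smooth and supported in the compact interval `[a, b]` of positive reals. -/
structure IsMellinTest (W : ℝ → ℂ) (a b : ℝ) : Prop where
  smooth : ContDiff ℝ (⊤ : ℕ∞) W
  pos : 0 < a
  eq_zero : ∀ u, u ∉ Set.Icc a b → W u = 0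

namespace IsMellinTest

open MeasureTheory Set Filter Topology
open scoped FourierTransform SchwartzMap

variable {W : ℝ → ℂ} {a b : ℝ}

theorem comp_mul_left (hW : IsMellinTest W a b) {d : ℝ} (hd : 0 < d) :
    IsMellinTest (fun u => W (d * u)) (a / d) (b / d) where
  smooth := hW.smooth.comp (contDiff_const.mul contDiff_id)
  pos := div_pos hW.pos hd
  eq_zero u hu := hW.eq_zero _ fun h => hu
    ⟨(div_le_iff₀ hd).mpr (by linarith [h.1]), (le_div_iff₀ hd).mpr (by linarith [h.2])⟩

theorem isBigO_atTop (hW : IsMellinTest W a b) (f : ℝ → ℝ) : W =O[atTop] f := by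
  have : W =ᶠ[atTop] fun _ => (0 : ℂ) := by
    filter_upwards [eventually_gt_atTop b] with u hu
    exact hW.eq_zero u fun h => absurd h.2 (not_le.mpr hu)
  exact this.trans_isBigO (Asymptotics.isBigO_zero _ _)

theorem isBigO_zero (hW : IsMellinTest W a b) (f : ℝ → ℝ) : W =O[𝓝[>] 0] f := by
  have : W =ᶠ[𝓝[>] 0] fun _ => (0 : ℂ) := by
    filter_upwards [nhdsWithin_le_nhds (eventually_lt_nhds hW.pos)] with u hu
    exact hW.eq_zero u fun h => absurd h.1 (not_le.mpr hu)
  exact this.trans_isBigO (Asymptotics.isBigO_zero _ _)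

theorem mellinConvergent (hW : IsMellinTest W a b) (s : ℂ) : MellinConvergent W s :=
  mellinConvergent_of_isBigO_rpow (hW.smooth.continuous.locallyIntegrable.locallyIntegrableOn _)
    (hW.isBigO_atTop _) (lt_add_one s.re) (hW.isBigO_zero _) (sub_one_lt s.re)

theorem differentiable_mellin (hW : IsMellinTest W a b) : Differentiable ℂ (mellin W) := fun s =>
  mellin_differentiableAt_of_isBigO_rpow
    (hW.smooth.continuous.locallyIntegrable.locallyIntegrableOn _)
    (hW.isBigO_atTop _) (lt_add_one s.re) (hW.isBigO_zero _) (sub_one_lt s.re)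

theorem exists_norm_mellin_le (hW : IsMellinTest W a b) (σ₁ σ₂ : ℝ) :
    ∃ M : ℝ, ∀ s : ℂ, σ₁ ≤ s.re → s.re ≤ σ₂ → ‖mellin W s‖ ≤ M := by
  have h₁ := (hW.mellinConvergent (σ₁ : ℂ)).norm
  have h₂ := (hW.mellinConvergent (σ₂ : ℂ)).norm
  refine ⟨_, fun s hs₁ hs₂ => (norm_integral_le_integral_norm _).trans
    (setIntegral_mono_on (hW.mellinConvergent s).norm (h₁.add h₂) measurableSet_Ioi
      fun t (ht : 0 < t) => ?_)⟩
  simp only [Pi.add_apply, norm_smul, Complex.norm_cpow_eq_rpow_re_of_pos ht, Complex.sub_re,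
    Complex.one_re, Complex.ofReal_re, ← add_mul]
  gcongr
  -- For every σ in [σ₁, σ₂], t^(σ-1) is at most t^(σ₁-1) when t ≤ 1 and at most t^(σ₂-1) when t ≥
  -- 1, hence at most their sum.
  rcases le_total t 1 with h | h
  · have := Real.rpow_le_rpow_of_exponent_ge ht h (sub_le_sub_right hs₁ 1)
    have := Real.rpow_nonneg ht.le (σ₂ - 1)
    linarith
  · have := Real.rpow_le_rpow_of_exponent_le h (sub_le_sub_right hs₂ 1)
    have := Real.rpow_nonneg ht.le (σ₁ - 1)
    linarith

theorem exp_mem_iff_of_ne_zero (hW : IsMellinTest W a b) {v : ℝ} (hv : W (Real.exp (-v)) ≠ 0) :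
    v ∈ Icc (-Real.log b) (-Real.log a) := by
  have h : Real.exp (-v) ∈ Icc a b := by
    by_contra h; exact hv (hW.eq_zero _ h)
  have h1 := (Real.le_log_iff_exp_le (by linarith [hW.pos, h.1, h.2])).mpr h.2
  have h2 := (Real.log_le_iff_le_exp hW.pos).mpr h.1
  constructor <;> linarith

theorem hasCompactSupport_exp (hW : IsMellinTest W a b) (σ : ℝ) :
    HasCompactSupport fun v : ℝ => Real.exp (-σ * v) • W (Real.exp (-v)) := by
  refine HasCompactSupport.intro (K := Icc (-Real.log b) (-Real.log a)) isCompact_Icc fun v hv => ?_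
  by_contra h
  exact hv (hW.exp_mem_iff_of_ne_zero fun h0 => h (by rw [h0, smul_zero]))

theorem contDiff_exp (hW : IsMellinTest W a b) (σ : ℝ) :
    ContDiff ℝ (⊤ : ℕ∞) fun v : ℝ => Real.exp (-σ * v) • W (Real.exp (-v)) :=
  (Real.contDiff_exp.comp (contDiff_const.mul contDiff_id)).smul
    (hW.smooth.comp (Real.contDiff_exp.comp contDiff_neg))

/-- The Schwartz function `v ↦ exp (-σ v) W (exp (-v))`. -/
noncomputable def toSchwartz (hW : IsMellinTest W a b) (σ : ℝ) : 𝓢(ℝ, ℂ) :=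
  (hW.hasCompactSupport_exp σ).toSchwartzMap (hW.contDiff_exp σ)

theorem mellin_eq_fourier_toSchwartz (hW : IsMellinTest W a b) (σ t : ℝ) :
    mellin W (σ + t * Complex.I) = 𝓕 (hW.toSchwartz σ) (t / (2 * Real.pi)) := by
  have h : (hW.toSchwartz σ : ℝ → ℂ) = fun v => Real.exp (-σ * v) • W (Real.exp (-v)) := rfl
  rw [mellin_eq_fourier, SchwartzMap.fourier_coe, h]
  simp

theorem verticalIntegrable_mellin (hW : IsMellinTest W a b) (σ : ℝ) :
    Integrable fun t : ℝ => mellin W (σ + t * Complex.I) := by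
  simp_rw [hW.mellin_eq_fourier_toSchwartz]
  exact (𝓕 (hW.toSchwartz σ)).integrable.comp_div (by positivity)

theorem mellinInv_mellin (hW : IsMellinTest W a b) (σ : ℝ) {u : ℝ} (hu : 0 < u) :
    mellinInv σ (mellin W) u = W u :=
  mellinInv_mellin_eq σ W hu (hW.mellinConvergent σ) (hW.verticalIntegrable_mellin σ)
    hW.smooth.continuous.continuousAt

/-- After the substitution u = exp(-v), the majorant B² exp(-v) dv becomes B² du on [a, b]. -/
theorem integral_norm_sq_le_of_bound (ha : 0 < a) (hab : a ≤ b) {B : ℝ}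
    (φ : 𝓢(ℝ, ℂ)) (hφ : ∀ v ∈ Icc (-Real.log b) (-Real.log a), ‖φ v‖ ≤ B * Real.exp (-v / 2))
    (hφ0 : ∀ v ∉ Icc (-Real.log b) (-Real.log a), φ v = 0) :
    ∫ v, ‖φ v‖ ^ 2 ≤ B ^ 2 * (b - a) := by
  have hlog : -Real.log b ≤ -Real.log a := neg_le_neg (Real.log_le_log ha hab)
  have h1 : ∫ v, ‖φ v‖ ^ 2 = ∫ v in Icc (-Real.log b) (-Real.log a), ‖φ v‖ ^ 2 := by
    refine (setIntegral_eq_integral_of_forall_compl_eq_zero fun v hv => ?_).symm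
    rw [hφ0 v hv]; simp
  have hexp : ∫ v in (-Real.log b)..(-Real.log a), Real.exp (-v) = b - a := by
    rw [intervalIntegral.integral_comp_neg, integral_exp]
    simp [Real.exp_log ha, Real.exp_log (ha.trans_le hab)]
  rw [h1]
  calc ∫ v in Icc (-Real.log b) (-Real.log a), ‖φ v‖ ^ 2
      ≤ ∫ v in Icc (-Real.log b) (-Real.log a), B ^ 2 * Real.exp (-v) := by
        refine setIntegral_mono_on ?_ ?_ measurableSet_Icc fun v hv => ?_
        · exact (φ.continuous.norm.pow 2).continuousOn.integrableOn_compact isCompact_Icc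
        · exact (by fun_prop : Continuous fun v : ℝ => B ^ 2 * Real.exp (-v)).continuousOn.integrableOn_compact
            isCompact_Icc
        · calc ‖φ v‖ ^ 2 ≤ (B * Real.exp (-v / 2)) ^ 2 := by gcongr; exact hφ v hv
            _ = B ^ 2 * Real.exp (-v) := by
              rw [mul_pow, ← Real.exp_nat_mul]; congr 2; push_cast; ring
    _ = B ^ 2 * (b - a) := by
        rw [integral_Icc_eq_integral_Ioc, ← intervalIntegral.integral_of_le hlog,
          intervalIntegral.integral_const_mul, hexp]

/-- On Re s = 1/2 the Mellin transform is the Fourier transform of exp(-v/2) W(exp(-v)) at t/(2π),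
so this is Plancherel; rescaling the frequency produces the factor 2π. -/
theorem integral_norm_sq_mellin_le (hW : IsMellinTest W a b) (hab : a ≤ b) {B : ℝ}
    (hB : ∀ u, ‖W u‖ ≤ B) :
    ∫ t : ℝ, ‖mellin W (1 / 2 + t * Complex.I)‖ ^ 2 ≤ 2 * Real.pi * (B ^ 2 * (b - a)) := by
  have h1 : ∀ t : ℝ, mellin W (1 / 2 + t * Complex.I)
      = 𝓕 (hW.toSchwartz (1 / 2)) (t / (2 * Real.pi)) := fun t => by
    rw [← hW.mellin_eq_fourier_toSchwartz]; simp
  simp_rw [h1]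
  rw [Measure.integral_comp_div (fun ξ => ‖𝓕 (hW.toSchwartz (1 / 2)) ξ‖ ^ 2),
    SchwartzMap.integral_norm_sq_fourier, smul_eq_mul, abs_of_pos (by positivity)]
  refine mul_le_mul_of_nonneg_left ?_ (by positivity)
  refine integral_norm_sq_le_of_bound hW.pos hab _ (fun v _ => ?_) fun v hv => ?_
  · simp only [toSchwartz, HasCompactSupport.toSchwartzMap_toFun, norm_smul, Real.norm_eq_abs,
      Real.abs_exp]
    rw [mul_comm, show -(1 / 2 : ℝ) * v = -v / 2 by ring]
    gcongr
    exact hB _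
  · simp only [toSchwartz, HasCompactSupport.toSchwartzMap_toFun]
    by_contra h
    exact hv (hW.exp_mem_iff_of_ne_zero fun h0 => h (by rw [h0, smul_zero]))

theorem integrable_norm_sq_mellin (hW : IsMellinTest W a b) :
    Integrable fun t : ℝ => ‖mellin W (1 / 2 + t * Complex.I)‖ ^ 2 := by
  have h1 : ∀ t : ℝ, mellin W (1 / 2 + t * Complex.I)
      = 𝓕 (hW.toSchwartz (1 / 2)) (t / (2 * Real.pi)) := fun t => by
    rw [← hW.mellin_eq_fourier_toSchwartz]; simp
  simp_rw [h1]
  refine Integrable.comp_div (g := fun ξ => ‖𝓕 (hW.toSchwartz (1 / 2)) ξ‖ ^ 2) ?_ (by positivity)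
  exact ((𝓕 (hW.toSchwartz (1 / 2))).memLp 2).integrable_norm_pow two_ne_zero

theorem norm_fourier_deriv_toSchwartz (hW : IsMellinTest W a b) (t : ℝ) :
    ‖𝓕 (SchwartzMap.derivCLM ℝ ℂ (hW.toSchwartz (1 / 2))) (t / (2 * Real.pi))‖
      = |t| * ‖mellin W (1 / 2 + t * Complex.I)‖ := by
  have h1 : mellin W (1 / 2 + t * Complex.I)
      = 𝓕 (hW.toSchwartz (1 / 2)) (t / (2 * Real.pi)) := by
    rw [← hW.mellin_eq_fourier_toSchwartz]; simp
  have h2 : 𝓕 (SchwartzMap.derivCLM ℝ ℂ (hW.toSchwartz (1 / 2))) (t / (2 * Real.pi))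
      = (2 * Real.pi * Complex.I * (t / (2 * Real.pi) : ℝ)) •
        𝓕 (hW.toSchwartz (1 / 2)) (t / (2 * Real.pi)) := by
    have := congrFun (Real.fourier_deriv (hW.toSchwartz (1 / 2)).integrable
      (hW.toSchwartz (1 / 2)).differentiable
      (SchwartzMap.derivCLM ℝ ℂ (hW.toSchwartz (1 / 2))).integrable) (t / (2 * Real.pi))
    exact this
  rw [h2, h1, norm_smul]
  congr 1
  simp only [norm_mul, Complex.norm_I, Complex.norm_real, Complex.norm_ofNat, Real.norm_eq_abs,
    abs_div, abs_mul, abs_of_pos Real.pi_pos, mul_one, abs_two]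
  field_simp

/-- Multiplication by t is differentiation in v. The derivative of exp(-v/2) W(exp(-v)) is
-exp(-v/2)(W(u)/2 + u W'(u)) at u = exp(-v) ≤ b, whence the constant B/2 + bB'. -/
theorem integral_sq_mul_norm_sq_mellin_le (hW : IsMellinTest W a b) (hab : a ≤ b) {B B' : ℝ}
    {W' : ℝ → ℂ} (hB : ∀ u, ‖W u‖ ≤ B) (hW' : ∀ u, HasDerivAt W (W' u) u)
    (hB' : ∀ u, ‖W' u‖ ≤ B') :
    ∫ t : ℝ, t ^ 2 * ‖mellin W (1 / 2 + t * Complex.I)‖ ^ 2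
      ≤ 2 * Real.pi * ((B / 2 + b * B') ^ 2 * (b - a)) := by
  have h1 : ∀ t : ℝ, t ^ 2 * ‖mellin W (1 / 2 + t * Complex.I)‖ ^ 2 =
      ‖𝓕 (SchwartzMap.derivCLM ℝ ℂ (hW.toSchwartz (1 / 2))) (t / (2 * Real.pi))‖ ^ 2 := fun t => by
    rw [hW.norm_fourier_deriv_toSchwartz, mul_pow, sq_abs]
  simp_rw [h1]
  rw [Measure.integral_comp_div
    (fun ξ => ‖𝓕 (SchwartzMap.derivCLM ℝ ℂ (hW.toSchwartz (1 / 2))) ξ‖ ^ 2),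
    SchwartzMap.integral_norm_sq_fourier, smul_eq_mul, abs_of_pos (by positivity)]
  refine mul_le_mul_of_nonneg_left ?_ (by positivity)
  have hderiv : ∀ v : ℝ, SchwartzMap.derivCLM ℝ ℂ (hW.toSchwartz (1 / 2)) v =
      Real.exp (-v / 2) • (-(1 / 2 : ℝ) • W (Real.exp (-v))
        - Real.exp (-v) • W' (Real.exp (-v))) := by
    intro v
    rw [SchwartzMap.derivCLM_apply]
    have he : HasDerivAt (fun v : ℝ => Real.exp (-(1 / 2) * v))
        (Real.exp (-(1 / 2) * v) * (-(1 / 2) * 1)) v :=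
      ((hasDerivAt_id v).const_mul (-(1 / 2) : ℝ)).exp
    have hn : HasDerivAt (fun v : ℝ => Real.exp (-v)) (Real.exp (-v) * -1) v :=
      (hasDerivAt_neg v).exp
    have hw : HasDerivAt (fun v : ℝ => W (Real.exp (-v)))
        ((Real.exp (-v) * -1) • W' (Real.exp (-v))) v := (hW' _).scomp v hn
    have := (he.smul hw).deriv
    refine Eq.trans (b := deriv (fun v : ℝ => Real.exp (-(1 / 2) * v) • W (Real.exp (-v))) v) ?_ ?_
    · rfl
    · refine Eq.trans this ?_
      rw [show -(1 / 2 : ℝ) * v = -v / 2 by ring]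
      simp only [Complex.real_smul]
      push_cast
      ring
  refine integral_norm_sq_le_of_bound hW.pos hab _ (fun v hv => ?_) fun v hv => ?_
  · rw [hderiv, norm_smul, Real.norm_eq_abs, Real.abs_exp, mul_comm]
    gcongr
    have hvb : Real.exp (-v) ≤ b := by
      rw [← Real.le_log_iff_exp_le (hW.pos.trans_le hab)]
      linarith [hv.1]
    calc _ ≤ ‖-(1 / 2 : ℝ) • W (Real.exp (-v))‖ + ‖Real.exp (-v) • W' (Real.exp (-v))‖ :=
          norm_sub_le _ _
      _ ≤ B / 2 + b * B' := by
          rw [norm_smul, norm_smul, Real.norm_eq_abs, Real.norm_eq_abs, Real.abs_exp]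
          refine add_le_add ?_ ?_
          · have := hB (Real.exp (-v))
            rw [abs_neg, abs_of_pos (by norm_num)]; linarith
          · exact mul_le_mul hvb (hB' _) (norm_nonneg _) (hW.pos.le.trans hab)
  · rw [SchwartzMap.derivCLM_apply]
    have hev : (hW.toSchwartz (1 / 2) : ℝ → ℂ) =ᶠ[𝓝 v] fun _ => 0 := by
      filter_upwards [isClosed_Icc.isOpen_compl.mem_nhds hv] with w hw
      simp only [toSchwartz, HasCompactSupport.toSchwartzMap_toFun]
      by_contra h
      exact hw (hW.exp_mem_iff_of_ne_zero fun h0 => h (by rw [h0, smul_zero]))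
    rw [hev.deriv_eq]; simp

theorem integrable_sq_mul_norm_sq_mellin (hW : IsMellinTest W a b) :
    Integrable fun t : ℝ => t ^ 2 * ‖mellin W (1 / 2 + t * Complex.I)‖ ^ 2 := by
  have h1 : ∀ t : ℝ, t ^ 2 * ‖mellin W (1 / 2 + t * Complex.I)‖ ^ 2 =
      ‖𝓕 (SchwartzMap.derivCLM ℝ ℂ (hW.toSchwartz (1 / 2))) (t / (2 * Real.pi))‖ ^ 2 := fun t => by
    rw [hW.norm_fourier_deriv_toSchwartz, mul_pow, sq_abs]
  simp_rw [h1]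
  refine Integrable.comp_div
    (g := fun ξ => ‖𝓕 (SchwartzMap.derivCLM ℝ ℂ (hW.toSchwartz (1 / 2))) ξ‖ ^ 2) ?_ (by positivity)
  exact ((𝓕 (SchwartzMap.derivCLM ℝ ℂ (hW.toSchwartz (1 / 2)))).memLp 2).integrable_norm_pow
    two_ne_zero

end IsMellinTest

/-! ### Moving the line of integration from Re s = 2 to Re s = 1/2. -/

namespace IsLContinuation

open MeasureTheory Set Filter Topology

variable {f : ArithmeticFunction ℂ} {q : ℕ} {χ : DirichletCharacter ℂ q} {Λ : ℂ → ℂ}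

theorem continuous_vertical (hΛ : IsLContinuation f χ Λ) {σ : ℝ} (hσ : 1 / 2 ≤ σ) (hσ1 : σ ≠ 1) :
    Continuous fun t : ℝ => Λ (σ + t * Complex.I) := by
  refine hΛ.continuous_boundary.comp_continuous (by fun_prop) fun t => ⟨by simpa using hσ, fun h => ?_⟩
  have := congrArg Complex.re (mem_singleton_iff.mp h)
  simp at this
  exact hσ1 this

theorem neg_one_le_order (hΛ : IsLContinuation f χ Λ) : -1 ≤ meromorphicOrderAt Λ 1 := by
  by_cases h : χ = 1
  · exact hΛ.order_one_principal h
  · exact le_trans (by decide) (hΛ.order_one_nonprincipal h)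

/-- A zero of `h` at 1 compensates a pole of order at most one, so the product has nonnegative order
there. -/
theorem exists_tendsto_mul (hΛ : IsLContinuation f χ Λ) {h : ℂ → ℂ} (hh : Differentiable ℂ h)
    (h1 : h 1 = 0) : ∃ c, Tendsto (fun s => Λ s * h s) (𝓝[≠] 1) (𝓝 c) := by
  have han : AnalyticAt ℂ h 1 := hh.analyticAt 1
  have hpos : 1 ≤ meromorphicOrderAt h 1 := by
    rw [han.meromorphicOrderAt_eq]
    have h0 : analyticOrderAt h 1 ≠ 0 := by
      rw [Ne, han.analyticOrderAt_eq_zero]; simpa using h1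
    generalize analyticOrderAt h 1 = n at h0 ⊢
    cases n with
    | top => exact le_top
    | coe n =>
      have : 1 ≤ n := Nat.one_le_iff_ne_zero.mpr fun h => h0 (by simp [h])
      change ((1 : ℤ) : WithTop ℤ) ≤ ((n : ℤ) : WithTop ℤ)
      exact_mod_cast this
  refine tendsto_nhds_of_meromorphicOrderAt_nonneg
    (f := fun s => Λ s * h s) (hΛ.meromorphic_one.mul han.meromorphicAt) ?_
  rw [fun_meromorphicOrderAt_mul hΛ.meromorphic_one han.meromorphicAt]
  calc (0 : WithTop ℤ) = -1 + 1 := by decide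
    _ ≤ _ := add_le_add hΛ.neg_one_le_order hpos

/-- Growth exp(|t|^A) with arbitrary A is only beaten by doubly exponential decay, which is why `h`
is required to decay like exp(-c cosh t). -/
theorem tendsto_horizontal (hΛ : IsLContinuation f χ Λ) {h : ℂ → ℂ} {E c : ℝ}
    (hc : 0 < c) (hE : ∀ s : ℂ, 1 / 2 ≤ s.re → s.re ≤ 2 → ‖h s‖ ≤ E * Real.exp (-c * Real.cosh s.im)) :
    ∃ g : ℝ → ℝ, Tendsto g atTop (𝓝 0) ∧ ∀ T : ℝ, 1 ≤ T → ∀ s : ℂ, |s.im| = T →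
      1 / 2 ≤ s.re → s.re ≤ 2 → ‖Λ s * h s‖ ≤ g T := by
  obtain ⟨A, B, hAB⟩ := hΛ.finite_order
  refine ⟨fun T => (B * E) * Real.exp (T ^ A - c * Real.cosh T), ?_, fun T hT s hs h1 h2 => ?_⟩
  · rw [show (0 : ℝ) = (B * E) * 0 by ring]
    refine Tendsto.const_mul _ (Real.tendsto_exp_atBot.comp ?_)
    have hlittle : ∀ᶠ T : ℝ in atTop, T ^ A ≤ c / 4 * Real.exp T := by
      filter_upwards [(isLittleO_rpow_exp_atTop A).bound (by positivity : 0 < c / 4),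
        eventually_ge_atTop 0] with T h hT
      rwa [Real.norm_of_nonneg (by positivity), Real.norm_of_nonneg (by positivity)] at h
    have hexp : Tendsto (fun T : ℝ => -(c / 4) * Real.exp T) atTop atBot :=
      Real.tendsto_exp_atTop.const_mul_atTop_of_neg (by linarith)
    refine tendsto_atBot_mono' _ ?_ hexp
    filter_upwards [hlittle] with T hT
    have : Real.exp T / 2 ≤ Real.cosh T := by
      rw [Real.cosh_eq]; have := Real.exp_pos (-T); linarith
    nlinarith
  · rw [norm_mul]
    have hΛs := hAB s h1 (by rw [hs]; exact hT)
    have hhs := hE s h1 h2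
    rw [hs] at hΛs
    rw [← Real.cosh_abs, hs] at hhs
    calc _ ≤ (B * Real.exp (T ^ A)) * (E * Real.exp (-c * Real.cosh T)) :=
          mul_le_mul hΛs hhs (norm_nonneg _) ((norm_nonneg _).trans hΛs)
      _ = B * E * (Real.exp (T ^ A) * Real.exp (-c * Real.cosh T)) := by ring
      _ = _ := by rw [← Real.exp_add]; ring_nf

theorem integral_shift (hΛ : IsLContinuation f χ Λ) {h : ℂ → ℂ} (hh : Differentiable ℂ h)
    (h1 : h 1 = 0) {E c : ℝ} (hc : 0 < c)
    (hE : ∀ s : ℂ, 1 / 2 ≤ s.re → s.re ≤ 2 → ‖h s‖ ≤ E * Real.exp (-c * Real.cosh s.im))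
    (hl : Integrable fun t : ℝ => Λ (1 / 2 + t * Complex.I) * h (1 / 2 + t * Complex.I))
    (hr : Integrable fun t : ℝ => Λ (2 + t * Complex.I) * h (2 + t * Complex.I)) :
    ∫ t : ℝ, Λ (1 / 2 + t * Complex.I) * h (1 / 2 + t * Complex.I) =
      ∫ t : ℝ, Λ (2 + t * Complex.I) * h (2 + t * Complex.I) := by
  obtain ⟨l, hlim⟩ := hΛ.exists_tendsto_mul hh h1
  obtain ⟨g, hg0, hg⟩ := hΛ.tendsto_horizontal hc hE
  -- The value of `Λ` at 1 is arbitrary; replacing the product there by its limit makes it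
  -- continuous on the closed half-plane, and Cauchy's theorem tolerates the exceptional point 1.
  set F : ℂ → ℂ := Function.update (fun s => Λ s * h s) 1 l with hF
  have hFne : ∀ s, s ≠ 1 → F s = Λ s * h s := fun s hs => Function.update_of_ne hs _ _
  have hcont : ContinuousOn F {s : ℂ | 1 / 2 ≤ s.re} := by
    intro s hs
    by_cases hs1 : s = 1
    · subst hs1
      exact (continuousAt_update_same.mpr hlim).continuousWithinAt
    · have h2 : ContinuousOn (fun s => Λ s * h s) ({s : ℂ | 1 / 2 ≤ s.re} \ {1}) :=
        hΛ.continuous_boundary.mul hh.continuous.continuousOn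
      have h3 : ContinuousWithinAt (fun s => Λ s * h s) {s : ℂ | 1 / 2 ≤ s.re} s := by
        refine (h2 s ⟨hs, hs1⟩).mono_of_mem_nhdsWithin ?_
        rw [sdiff_eq]
        exact inter_mem_nhdsWithin _ (isOpen_compl_singleton.mem_nhds hs1)
      refine h3.congr_of_eventuallyEq ?_ (hFne s hs1)
      filter_upwards [nhdsWithin_le_nhds (isOpen_compl_singleton.mem_nhds hs1)] with z hz
      exact hFne z hz
  have hdiff : ∀ s : ℂ, 1 / 2 < s.re → s ≠ 1 → DifferentiableAt ℂ F s := by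
    intro s hs hs1
    have hopen : IsOpen ({s : ℂ | 1 / 2 < s.re} \ {1}) :=
      (isOpen_lt continuous_const Complex.continuous_re).sdiff isClosed_singleton
    have h2 := (hΛ.holomorphic.differentiableAt (hopen.mem_nhds ⟨hs, hs1⟩)).mul (hh s)
    refine h2.congr_of_eventuallyEq ?_
    filter_upwards [isOpen_compl_singleton.mem_nhds hs1] with z hz
    exact hFne z hz
  have hrect : ∀ T : ℝ, 1 ≤ T →
      (∫ x in (1 / 2 : ℝ)..2, F (x + (-T : ℝ) * Complex.I))
        - (∫ x in (1 / 2 : ℝ)..2, F (x + T * Complex.I))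
        + Complex.I • (∫ y in (-T)..T, F ((2 : ℝ) + y * Complex.I))
        - Complex.I • (∫ y in (-T)..T, F ((1 / 2 : ℝ) + y * Complex.I)) = 0 := by
    intro T hT
    have := Complex.integral_boundary_rect_eq_zero_of_differentiable_on_off_countable F
      ⟨1 / 2, -T⟩ ⟨2, T⟩ {1} (countable_singleton 1) (hcont.mono fun s hs => ?_) (fun s hs => ?_)
    · simpa using this
    · have := hs.1
      simp only [uIcc_of_le (by norm_num : (1 / 2 : ℝ) ≤ 2), mem_preimage] at this
      exact this.1
    · have h3 := hs.1.1
      simp only [min_eq_left (by norm_num : (1 / 2 : ℝ) ≤ 2), mem_preimage] at h3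
      exact hdiff s h3.1 hs.2
  have hhor : ∀ T : ℝ, 1 ≤ T → ∀ τ : ℝ, |τ| = T →
      ‖∫ x in (1 / 2 : ℝ)..2, F (x + τ * Complex.I)‖ ≤ g T * |2 - 1 / 2| := by
    intro T hT τ hτ
    refine intervalIntegral.norm_integral_le_of_norm_le_const fun x hx => ?_
    rw [uIoc_of_le (by norm_num)] at hx
    have hne : (x : ℂ) + τ * Complex.I ≠ 1 := by
      intro h
      have := congrArg Complex.im h
      simp at this
      rw [this, abs_zero] at hτ
      linarith
    rw [hFne _ hne]
    exact hg T hT _ (by simpa using hτ) (by simpa using hx.1.le) (by simpa using hx.2)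
  have hv : ∀ σ : ℝ, σ ≠ 1 → ∀ y : ℝ, F (σ + y * Complex.I) =
      Λ (σ + y * Complex.I) * h (σ + y * Complex.I) := by
    intro σ hσ y
    refine hFne _ fun hs => hσ ?_
    have := congrArg Complex.re hs
    simpa using this
  -- The constant 3 comes from two horizontal sides of length 3/2.
  have hle : ∀ T : ℝ, 1 ≤ T → ‖(∫ y in (-T)..T, F ((2 : ℝ) + y * Complex.I))
      - ∫ y in (-T)..T, F ((1 / 2 : ℝ) + y * Complex.I)‖ ≤ 3 * g T := by
    intro T hT
    have e := hrect T hT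
    have hb1 := hhor T hT (-T) (by rw [abs_neg, abs_of_nonneg (by linarith)])
    have hb2 := hhor T hT T (abs_of_nonneg (by linarith))
    set I1 := ∫ x in (1 / 2 : ℝ)..2, F (x + (-T : ℝ) * Complex.I)
    set I2 := ∫ x in (1 / 2 : ℝ)..2, F (x + T * Complex.I)
    set J2 := ∫ y in (-T)..T, F ((2 : ℝ) + y * Complex.I)
    set J1 := ∫ y in (-T)..T, F ((1 / 2 : ℝ) + y * Complex.I)
    have : Complex.I * (J2 - J1) = I2 - I1 := by
      rw [smul_eq_mul, smul_eq_mul] at e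
      linear_combination e
    calc ‖J2 - J1‖ = ‖Complex.I * (J2 - J1)‖ := by simp
      _ = ‖I2 - I1‖ := by rw [this]
      _ ≤ ‖I2‖ + ‖I1‖ := norm_sub_le _ _
      _ ≤ 3 * g T := by
        rw [abs_of_pos (by norm_num)] at hb1 hb2
        linarith
  have hl' : Integrable fun t : ℝ => F ((1 / 2 : ℝ) + t * Complex.I) := by
    simp_rw [hv (1 / 2) (by norm_num)]
    simpa using hl
  have hr' : Integrable fun t : ℝ => F ((2 : ℝ) + t * Complex.I) := by
    simp_rw [hv 2 (by norm_num)]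
    simpa using hr
  have hlim1 := (intervalIntegral_tendsto_integral hr' tendsto_neg_atTop_atBot tendsto_id).sub
    (intervalIntegral_tendsto_integral hl' tendsto_neg_atTop_atBot tendsto_id)
  have hlim0 : Tendsto (fun T : ℝ => (∫ y in (-T)..T, F ((2 : ℝ) + y * Complex.I))
      - ∫ y in (-T)..T, F ((1 / 2 : ℝ) + y * Complex.I)) atTop (𝓝 0) := by
    refine squeeze_zero_norm' (a := fun T => 3 * g T) ?_ (by simpa using hg0.const_mul 3)
    filter_upwards [eventually_ge_atTop 1] with T hT using hle T hT
  have := sub_eq_zero.mp (tendsto_nhds_unique hlim1 hlim0)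
  simp_rw [hv (1 / 2) (by norm_num), hv 2 (by norm_num)] at this
  simpa using this.symm

end IsLContinuation

/-- An entire function tending to `1` as `δ → 0`, and decaying doubly exponentially along the
vertical lines of the strip `1 / 2 ≤ Re s ≤ 2` for `δ > 0`. -/
noncomputable def stripDamping (δ : ℝ) (s : ℂ) : ℂ := Complex.exp (-δ * Complex.cos (s - 5 / 4))

theorem differentiable_stripDamping (δ : ℝ) : Differentiable ℂ (stripDamping δ) := by
  unfold stripDamping; fun_prop

/-- Re cos(s - 5/4) = cos(σ - 5/4) cosh t. The strip is centred at 5/4 with half-width 3/4 < π/2,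
and there cos(σ - 5/4) ≥ 1 - 9/32 ≥ 1/2. -/
theorem norm_stripDamping_le {δ : ℝ} (hδ : 0 ≤ δ) {s : ℂ} (h1 : 1 / 2 ≤ s.re) (h2 : s.re ≤ 2) :
    ‖stripDamping δ s‖ ≤ Real.exp (-(δ / 2) * Real.cosh s.im) := by
  rw [stripDamping, Complex.norm_exp]
  have hre : (-(δ : ℂ) * Complex.cos (s - 5 / 4)).re
      = -(δ * (Real.cos (s.re - 5 / 4) * Real.cosh s.im)) := by
    have : s - 5 / 4 = ((s.re - 5 / 4 : ℝ) : ℂ) + (s.im : ℝ) * Complex.I := by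
      apply Complex.ext <;> simp
    rw [this, Complex.cos_add_mul_I, ← Complex.ofReal_cos, ← Complex.ofReal_sin,
      ← Complex.ofReal_cosh, ← Complex.ofReal_sinh]
    generalize Real.cos (s.re - 5 / 4) = u, Real.sin (s.re - 5 / 4) = v, Real.cosh s.im = w,
      Real.sinh s.im = z
    simp
  rw [hre]
  have hcos : 1 / 2 ≤ Real.cos (s.re - 5 / 4) := by
    have := Real.one_sub_sq_div_two_le_cos (x := s.re - 5 / 4)
    nlinarith
  have := Real.cosh_pos s.im
  refine Real.exp_le_exp.mpr ?_
  have h3 : 1 / 2 * Real.cosh s.im ≤ Real.cos (s.re - 5 / 4) * Real.cosh s.im := by gcongr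
  have h4 := mul_le_mul_of_nonneg_left h3 hδ
  linarith

theorem norm_stripDamping_le_one {δ : ℝ} (hδ : 0 ≤ δ) {s : ℂ} (h1 : 1 / 2 ≤ s.re) (h2 : s.re ≤ 2) :
    ‖stripDamping δ s‖ ≤ 1 := by
  refine (norm_stripDamping_le hδ h1 h2).trans (Real.exp_le_one_iff.mpr ?_)
  have := Real.cosh_pos s.im
  nlinarith [mul_nonneg hδ this.le]

namespace IsLContinuation

open MeasureTheory Set Filter Topology

variable {f : ArithmeticFunction ℂ} {q : ℕ} {χ : DirichletCharacter ℂ q} {Λ : ℂ → ℂ}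
  {W : ℝ → ℂ} {a b : ℝ}

theorem norm_le_tsum (hΛ : IsLContinuation f χ Λ)
    (hsum : LSeriesSummable (fun n : ℕ => f n * χ (n : ZMod q)) 2) (t : ℝ) :
    ‖Λ (2 + t * Complex.I)‖ ≤ ∑' n, ‖LSeries.term (fun n : ℕ => f n * χ (n : ZMod q)) 2 n‖ := by
  rw [hΛ.eq_LSeries _ (by simp), LSeries]
  refine tsum_of_norm_bounded hsum.norm.hasSum fun n => ?_
  exact LSeries.norm_term_le_of_re_le_re _ (by simp) n

theorem integrable_mul_mellin_two (hΛ : IsLContinuation f χ Λ)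
    (hsum : LSeriesSummable (fun n : ℕ => f n * χ (n : ZMod q)) 2) (hW : IsMellinTest W a b) :
    Integrable fun t : ℝ => Λ (2 + t * Complex.I) * mellin W (2 + t * Complex.I) := by
  have h2 := hW.verticalIntegrable_mellin 2
  have h3 := hΛ.continuous_vertical (σ := 2) (by norm_num) (by norm_num)
  push_cast at h2 h3
  exact h2.bdd_mul h3.aestronglyMeasurable (Eventually.of_forall fun t => hΛ.norm_le_tsum hsum t)

/-- The Mellin transform need not decay fast enough to beat the growth of `Λ` on horizontal
segments. The shift is therefore done for the damped integrand: on Re s = 1/2 the damping has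
modulus at most 1 and is discarded, and on Re s = 2 it is removed by dominated convergence as δ → 0.
-/
theorem norm_integral_two_le (hΛ : IsLContinuation f χ Λ)
    (hsum : LSeriesSummable (fun n : ℕ => f n * χ (n : ZMod q)) 2)
    (hW : IsMellinTest W a b) (hW1 : mellin W 1 = 0)
    (hint : Integrable fun t : ℝ =>
      ‖Λ (1 / 2 + t * Complex.I)‖ * ‖mellin W (1 / 2 + t * Complex.I)‖) :
    ‖∫ t : ℝ, Λ (2 + t * Complex.I) * mellin W (2 + t * Complex.I)‖ ≤
      ∫ t : ℝ, ‖Λ (1 / 2 + t * Complex.I)‖ * ‖mellin W (1 / 2 + t * Complex.I)‖ := by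
  have hmd := hW.differentiable_mellin
  obtain ⟨M, hM⟩ := hW.exists_norm_mellin_le (1 / 2) 2
  have hcΛ2 := hΛ.continuous_vertical (σ := 2) (by norm_num) (by norm_num)
  have hcΛ1 := hΛ.continuous_vertical (σ := 1 / 2) le_rfl (by norm_num)
  push_cast at hcΛ1 hcΛ2
  have hr0 := hΛ.integrable_mul_mellin_two hsum hW
  have hc2 : ∀ δ : ℝ, Continuous fun t : ℝ => stripDamping δ (2 + t * Complex.I) := fun δ =>
    (differentiable_stripDamping δ).continuous.comp (by fun_prop)
  have hc1 : ∀ δ : ℝ, Continuous fun t : ℝ => stripDamping δ (1 / 2 + t * Complex.I) := fun δ =>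
    (differentiable_stripDamping δ).continuous.comp (by fun_prop)
  have hm2 : Continuous fun t : ℝ => mellin W (2 + t * Complex.I) :=
    hmd.continuous.comp (by fun_prop)
  have hm1 : Continuous fun t : ℝ => mellin W (1 / 2 + t * Complex.I) :=
    hmd.continuous.comp (by fun_prop)
  have hle : ∀ δ : ℝ, 0 < δ → ‖∫ t : ℝ, Λ (2 + t * Complex.I) *
      (mellin W (2 + t * Complex.I) * stripDamping δ (2 + t * Complex.I))‖ ≤
      ∫ t : ℝ, ‖Λ (1 / 2 + t * Complex.I)‖ * ‖mellin W (1 / 2 + t * Complex.I)‖ := by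
    intro δ hδ
    have hb : ∀ t : ℝ, ‖Λ (1 / 2 + t * Complex.I) * (mellin W (1 / 2 + t * Complex.I) *
        stripDamping δ (1 / 2 + t * Complex.I))‖ ≤
        ‖Λ (1 / 2 + t * Complex.I)‖ * ‖mellin W (1 / 2 + t * Complex.I)‖ := by
      intro t
      rw [norm_mul, norm_mul, ← mul_assoc]
      exact mul_le_of_le_one_right (by positivity)
        (norm_stripDamping_le_one hδ.le (by simp) (by simp; norm_num))
    rw [← hΛ.integral_shift (h := fun s => mellin W s * stripDamping δ s)
      (hmd.mul (differentiable_stripDamping δ)) (by simp [hW1]) (E := M) (c := δ / 2) (by positivity)]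
    · exact (norm_integral_le_integral_norm _).trans
        (integral_mono_of_nonneg (Eventually.of_forall fun _ => norm_nonneg _) hint
          (Eventually.of_forall hb))
    · intro s hs1 hs2
      rw [norm_mul]
      exact mul_le_mul (hM s hs1 hs2) (norm_stripDamping_le hδ.le hs1 hs2) (norm_nonneg _)
        ((norm_nonneg _).trans (hM s hs1 hs2))
    · exact hint.mono' (hcΛ1.mul (hm1.mul (hc1 δ))).aestronglyMeasurable (Eventually.of_forall hb)
    · refine hr0.mono (hcΛ2.mul (hm2.mul (hc2 δ))).aestronglyMeasurable
        (Eventually.of_forall fun t => ?_)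
      rw [← mul_assoc, norm_mul _ (stripDamping δ _)]
      exact mul_le_of_le_one_right (norm_nonneg _)
        (norm_stripDamping_le_one hδ.le (by simp; norm_num) (by simp))
  have hlim : Tendsto (fun δ : ℝ => ∫ t : ℝ, Λ (2 + t * Complex.I) *
      (mellin W (2 + t * Complex.I) * stripDamping δ (2 + t * Complex.I))) (𝓝[>] 0)
      (𝓝 (∫ t : ℝ, Λ (2 + t * Complex.I) * mellin W (2 + t * Complex.I))) := by
    refine tendsto_integral_filter_of_dominated_convergence _
      (Eventually.of_forall fun δ => (hcΛ2.mul (hm2.mul (hc2 δ))).aestronglyMeasurable) ?_ hr0.norm ?_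
    · filter_upwards [self_mem_nhdsWithin] with δ hδ
      refine Eventually.of_forall fun t => ?_
      rw [← mul_assoc, norm_mul _ (stripDamping δ _)]
      exact mul_le_of_le_one_right (norm_nonneg _)
        (norm_stripDamping_le_one (le_of_lt hδ) (by simp; norm_num) (by simp))
    · refine Eventually.of_forall fun t => tendsto_nhdsWithin_of_tendsto_nhds ?_
      have hc : Continuous fun δ : ℝ => Λ (2 + t * Complex.I) *
          (mellin W (2 + t * Complex.I) * stripDamping δ (2 + t * Complex.I)) := by
        unfold stripDamping; fun_prop
      have := hc.tendsto 0
      simpa [stripDamping] using this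
  refine le_of_tendsto hlim.norm ?_
  filter_upwards [self_mem_nhdsWithin] with δ hδ using hle δ hδ

/-- Mellin inversion term by term; absolute convergence on Re s = 2 and integrability of the Mellin
transform justify exchanging sum and integral. -/
theorem hasSum_mul_test (hΛ : IsLContinuation f χ Λ)
    (hsum : LSeriesSummable (fun n : ℕ => f n * χ (n : ZMod q)) 2) (hW : IsMellinTest W a b) :
    HasSum (fun n : ℕ => f n * χ (n : ZMod q) * (2 * Real.pi * W n))
      (∫ t : ℝ, Λ (2 + t * Complex.I) * mellin W (2 + t * Complex.I)) := by
  set A : ℕ → ℂ := fun n => f n * χ (n : ZMod q) with hA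
  have hmi := hW.verticalIntegrable_mellin 2
  push_cast at hmi
  have hnorm : ∀ (n : ℕ) (t : ℝ), ‖LSeries.term A (2 + t * Complex.I) n‖ = ‖LSeries.term A 2 n‖ :=
    fun n t => by simp [LSeries.norm_term_eq]
  have hterm : ∀ (n : ℕ) (t : ℝ), LSeries.term A (2 + t * Complex.I) n =
      A n * (n : ℂ) ^ (-(2 + t * Complex.I)) := fun n t => by
    rcases eq_or_ne n 0 with rfl | hn
    · simp [hA]
    · rw [LSeries.term_of_ne_zero hn, Complex.cpow_neg, div_eq_mul_inv]
  have hmeas : ∀ n : ℕ, Continuous fun t : ℝ => LSeries.term A (2 + t * Complex.I) n := by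
    intro n
    rcases eq_or_ne n 0 with rfl | hn
    · simp only [LSeries.term_zero]; exact continuous_const
    · simp_rw [hterm]
      refine continuous_const.mul (Continuous.const_cpow (by fun_prop) (Or.inl ?_))
      exact_mod_cast hn
  have hint : ∀ n : ℕ, Integrable fun t : ℝ =>
      LSeries.term A (2 + t * Complex.I) n * mellin W (2 + t * Complex.I) := fun n =>
    hmi.bdd_mul (hmeas n).aestronglyMeasurable (Eventually.of_forall fun t => (hnorm n t).le)
  have key := hasSum_integral_of_summable_integral_norm hint (by
    simp_rw [norm_mul, hnorm, integral_const_mul]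
    exact hsum.norm.mul_right _)
  have e1 : (fun n : ℕ => f n * χ (n : ZMod q) * (2 * Real.pi * W n)) = fun n : ℕ =>
      ∫ t : ℝ, LSeries.term A (2 + t * Complex.I) n * mellin W (2 + t * Complex.I) := by
    funext n
    rcases eq_or_ne n 0 with rfl | hn
    · simp
    · have hinv := hW.mellinInv_mellin 2 (u := (n : ℝ)) (by positivity)
      rw [mellinInv] at hinv
      simp_rw [hterm, mul_assoc, integral_const_mul]
      rw [← hinv, hA]
      simp only [smul_eq_mul, Complex.real_smul]
      push_cast
      generalize ∫ t : ℝ, (n : ℂ) ^ (-(2 + t * Complex.I)) * mellin W (2 + t * Complex.I) = J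
      have : (Real.pi : ℂ) ≠ 0 := by exact_mod_cast Real.pi_ne_zero
      field_simp
  have e2 : ∫ t : ℝ, Λ (2 + t * Complex.I) * mellin W (2 + t * Complex.I) =
      ∫ t : ℝ, ∑' n : ℕ, LSeries.term A (2 + t * Complex.I) n * mellin W (2 + t * Complex.I) := by
    congr 1
    funext t
    rw [tsum_mul_right, hΛ.eq_LSeries _ (by simp), LSeries]
  rw [e1, e2]
  exact key

theorem norm_tsum_mul_test_le (hΛ : IsLContinuation f χ Λ)
    (hsum : LSeriesSummable (fun n : ℕ => f n * χ (n : ZMod q)) 2)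
    (hW : IsMellinTest W a b) (hW1 : mellin W 1 = 0)
    (hint : Integrable fun t : ℝ =>
      ‖Λ (1 / 2 + t * Complex.I)‖ * ‖mellin W (1 / 2 + t * Complex.I)‖) :
    ‖∑' n : ℕ, f n * χ (n : ZMod q) * W n‖ ≤
      ∫ t : ℝ, ‖Λ (1 / 2 + t * Complex.I)‖ * ‖mellin W (1 / 2 + t * Complex.I)‖ := by
  have h1 := (hΛ.hasSum_mul_test hsum hW).tsum_eq
  have h2 : ∑' n : ℕ, f n * χ (n : ZMod q) * (2 * Real.pi * W n) =
      (∑' n : ℕ, f n * χ (n : ZMod q) * W n) * (2 * Real.pi : ℝ) := by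
    rw [← tsum_mul_right]
    refine tsum_congr fun n => ?_
    push_cast; ring
  have h3 := hΛ.norm_integral_two_le hsum hW hW1 hint
  rw [← h1, h2, norm_mul, Complex.norm_real, Real.norm_of_nonneg (by positivity)] at h3
  refine le_trans (le_mul_of_one_le_right (norm_nonneg _) ?_) h3
  linarith [Real.pi_gt_three]

end IsLContinuation

/-! ### Weighted Cauchy–Schwarz and the weighted second moment. -/

open MeasureTheory Set in
theorem integrable_mul_and_integral_le_sqrt_mul_sqrt {p r w : ℝ → ℝ} (hp : Continuous p)
    (hr : Continuous r) (hp0 : ∀ t, 0 ≤ p t) (hr0 : ∀ t, 0 ≤ r t) (hw : ∀ t, 0 < w t)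
    (hpw : Integrable fun t => p t ^ 2 / w t) (hwr : Integrable fun t => w t * r t ^ 2)
    {U V : ℝ} (hU : 0 < U) (hV : 0 < V) (hpU : ∫ t, p t ^ 2 / w t ≤ U)
    (hrV : ∫ t, w t * r t ^ 2 ≤ V) :
    Integrable (fun t => p t * r t) ∧ ∫ t, p t * r t ≤ √U * √V := by
  have hsU := Real.sqrt_pos.mpr hU
  have hsV := Real.sqrt_pos.mpr hV
  -- The balancing parameter in pr ≤ (l/2) p²/w + (1/(2l)) w r². This form of Cauchy–Schwarz yields
  -- the integrability of pr as well.
  set l := √V / √U with hl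
  have hl0 : 0 < l := div_pos hsV hsU
  have hle : ∀ t, p t * r t ≤ l / 2 * (p t ^ 2 / w t) + 1 / (2 * l) * (w t * r t ^ 2) := by
    intro t
    have hwt := hw t
    have : l / 2 * (p t ^ 2 / w t) + 1 / (2 * l) * (w t * r t ^ 2) - p t * r t =
        (l * p t - w t * r t) ^ 2 / (2 * l * w t) := by
      field_simp; ring
    have h2 : 0 ≤ (l * p t - w t * r t) ^ 2 / (2 * l * w t) := by positivity
    linarith
  have hint := (hpw.const_mul (l / 2)).add (hwr.const_mul (1 / (2 * l)))
  refine ⟨hint.mono' (hp.mul hr).aestronglyMeasurable (Filter.Eventually.of_forall fun t => ?_), ?_⟩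
  · rw [Real.norm_of_nonneg (mul_nonneg (hp0 t) (hr0 t))]
    exact hle t
  · calc ∫ t, p t * r t
        ≤ ∫ t, (l / 2 * (p t ^ 2 / w t) + 1 / (2 * l) * (w t * r t ^ 2)) :=
          integral_mono_of_nonneg (Filter.Eventually.of_forall fun t => mul_nonneg (hp0 t) (hr0 t))
            hint (Filter.Eventually.of_forall hle)
      _ = l / 2 * (∫ t, p t ^ 2 / w t) + 1 / (2 * l) * (∫ t, w t * r t ^ 2) := by
          rw [integral_add (hpw.const_mul _) (hwr.const_mul _), integral_const_mul,
            integral_const_mul]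
      _ ≤ l / 2 * U + 1 / (2 * l) * V := by gcongr
      _ = √U * √V := by
          rw [hl]
          nth_rewrite 2 [← Real.sq_sqrt hU.le]
          nth_rewrite 3 [← Real.sq_sqrt hV.le]
          field_simp
          ring

-- Dyadic decomposition: on |t| ~ 2^j T the weight contributes (4^j T²)⁻¹ and the moment (2^j T)^β,
-- so the shells form a geometric series of ratio 2^β/4, which is less than 1 exactly when β < 2.
open MeasureTheory Set in
theorem exists_integral_div_sq_add_sq_le {β : ℝ} (hβ0 : 0 ≤ β) (hβ : β < 2) :
    ∃ C : ℝ, 0 < C ∧ ∀ (m : ℝ → ℝ) (M : ℝ), Continuous m → (∀ t, 0 ≤ m t) → 0 ≤ M →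
      (∀ T : ℝ, 1 ≤ T → ∫ t in (-T)..T, m t ≤ M * (1 + T) ^ β) → ∀ T : ℝ, 1 ≤ T →
        Integrable (fun t => m t / (T ^ 2 + t ^ 2)) ∧
          ∫ t, m t / (T ^ 2 + t ^ 2) ≤ C * M * T ^ (β - 2) := by
  set r : ℝ := 2 ^ β / 4 with hr
  have hr0 : 0 < r := by positivity
  have hr1 : r < 1 := by
    have : (2 : ℝ) ^ β < 2 ^ (2 : ℝ) := Real.rpow_lt_rpow_of_exponent_lt one_lt_two hβ
    norm_num at this
    rw [hr]; linarith
  refine ⟨4 * 2 ^ β * (1 - r)⁻¹, by have := sub_pos.mpr hr1; positivity,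
    fun m M hm hm0 hM hmom T hT => ?_⟩
  have hT0 : 0 < T := by linarith
  -- If j is least with |t| ≤ 2^j T and j ≥ 1, then t² ≥ 4^(j-1) T²; this accounts for the leading
  -- 4.
  set c : ℕ → ℝ := fun j => 4 * (1 / 4) ^ j * (T ^ 2)⁻¹ with hc
  have hc0 : ∀ j, 0 ≤ c j := fun j => by positivity
  have hcont : Continuous fun t => m t / (T ^ 2 + t ^ 2) :=
    hm.div (by fun_prop) fun t => by positivity
  have hpt : ∀ t, ENNReal.ofReal (m t / (T ^ 2 + t ^ 2)) ≤
      ∑' j, ENNReal.ofReal (c j) * (Icc (-(2 ^ j * T)) (2 ^ j * T)).indicator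
        (fun t => ENNReal.ofReal (m t)) t := by
    intro t
    have hex : ∃ j : ℕ, |t| ≤ 2 ^ j * T := by
      obtain ⟨j, hj⟩ := pow_unbounded_of_one_lt |t| (one_lt_two (α := ℝ))
      exact ⟨j, hj.le.trans (le_mul_of_one_le_right (by positivity) hT)⟩
    classical
    have hspec := Nat.find_spec hex
    have hmin : ∀ i < Nat.find hex, 2 ^ i * T < |t| := fun i hi => not_le.mp (Nat.find_min hex hi)
    generalize Nat.find hex = j at hspec hmin
    refine le_trans ?_ (ENNReal.le_tsum j)
    rw [indicator_of_mem (show t ∈ Icc (-(2 ^ j * T)) (2 ^ j * T) from abs_le.mp hspec),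
      ← ENNReal.ofReal_mul (hc0 j)]
    refine ENNReal.ofReal_le_ofReal ?_
    rw [div_eq_inv_mul]
    refine mul_le_mul_of_nonneg_right ?_ (hm0 t)
    rw [inv_le_iff_one_le_mul₀ (by positivity)]
    simp only [hc]
    cases j with
    | zero =>
      have : 4 * (1 / 4 : ℝ) ^ 0 * (T ^ 2)⁻¹ * (T ^ 2 + t ^ 2) = 4 + 4 * (t ^ 2 / T ^ 2) := by
        field_simp
      rw [this]
      have : 0 ≤ t ^ 2 / T ^ 2 := by positivity
      linarith
    | succ i =>
      have h1 := hmin i (Nat.lt_succ_self i)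
      have h2 : (2 ^ i * T) ^ 2 ≤ t ^ 2 := by
        rw [← sq_abs t]; exact pow_le_pow_left₀ (by positivity) h1.le 2
      have h3 : (2 ^ i * T) ^ 2 = 4 ^ i * T ^ 2 := by
        rw [mul_pow, ← pow_mul, mul_comm i 2, pow_mul]; norm_num
      have h4 : 4 * (1 / 4 : ℝ) ^ (i + 1) * (T ^ 2)⁻¹ * (4 ^ i * T ^ 2) = 1 := by
        rw [pow_succ, one_div, inv_pow]; field_simp
      calc (1 : ℝ) = 4 * (1 / 4 : ℝ) ^ (i + 1) * (T ^ 2)⁻¹ * (4 ^ i * T ^ 2) := h4.symm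
        _ ≤ _ := by gcongr; nlinarith
  have hint : ∀ j : ℕ, ∫⁻ t in Icc (-(2 ^ j * T)) (2 ^ j * T), ENNReal.ofReal (m t) ≤
      ENNReal.ofReal (M * (2 ^ β * (2 ^ β) ^ j * T ^ β)) := by
    intro j
    have h2j : (1 : ℝ) ≤ 2 ^ j := one_le_pow₀ one_le_two
    have hj : 1 ≤ 2 ^ j * T := by nlinarith
    rw [← ofReal_integral_eq_lintegral_ofReal (hm.continuousOn.integrableOn_compact isCompact_Icc)
      (Filter.Eventually.of_forall hm0), integral_Icc_eq_integral_Ioc,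
      ← intervalIntegral.integral_of_le (by linarith)]
    refine ENNReal.ofReal_le_ofReal ((hmom _ hj).trans ?_)
    gcongr
    calc (1 + 2 ^ j * T) ^ β ≤ (2 * (2 ^ j * T)) ^ β :=
          Real.rpow_le_rpow (by positivity) (by linarith) hβ0
      _ = 2 ^ β * (2 ^ β) ^ j * T ^ β := by
          rw [Real.mul_rpow (by norm_num) (by positivity), Real.mul_rpow (by positivity) hT0.le,
            ← Real.rpow_natCast, ← Real.rpow_mul (by norm_num), mul_comm (j : ℝ),
            Real.rpow_mul (by norm_num), Real.rpow_natCast, mul_assoc]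
  have hgeo : HasSum (fun j : ℕ => 4 * 2 ^ β * M * T ^ (β - 2) * r ^ j)
      (4 * 2 ^ β * (1 - r)⁻¹ * M * T ^ (β - 2)) := by
    have := (hasSum_geometric_of_lt_one hr0.le hr1).mul_left (4 * 2 ^ β * M * T ^ (β - 2))
    rwa [show 4 * 2 ^ β * M * T ^ (β - 2) * (1 - r)⁻¹ = 4 * 2 ^ β * (1 - r)⁻¹ * M * T ^ (β - 2) by
      ring] at this
  have hlin : ∫⁻ t, ENNReal.ofReal (m t / (T ^ 2 + t ^ 2)) ≤
      ENNReal.ofReal (4 * 2 ^ β * (1 - r)⁻¹ * M * T ^ (β - 2)) := by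
    calc ∫⁻ t, ENNReal.ofReal (m t / (T ^ 2 + t ^ 2))
        ≤ ∫⁻ t, ∑' j, ENNReal.ofReal (c j) * (Icc (-(2 ^ j * T)) (2 ^ j * T)).indicator
            (fun t => ENNReal.ofReal (m t)) t := lintegral_mono hpt
      _ = ∑' j, ENNReal.ofReal (c j) *
            ∫⁻ t in Icc (-(2 ^ j * T)) (2 ^ j * T), ENNReal.ofReal (m t) := by
          rw [lintegral_tsum]
          · refine tsum_congr fun j => ?_
            rw [lintegral_const_mul, lintegral_indicator measurableSet_Icc]
            exact hm.measurable.ennreal_ofReal.indicator measurableSet_Icc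
          · intro j
            exact ((hm.measurable.ennreal_ofReal.indicator measurableSet_Icc).const_mul _).aemeasurable
      _ ≤ ∑' j, ENNReal.ofReal (4 * 2 ^ β * M * T ^ (β - 2) * r ^ j) := by
          refine ENNReal.tsum_le_tsum fun j => (mul_le_mul_right (hint j) _).trans ?_
          rw [← ENNReal.ofReal_mul (hc0 j)]
          refine ENNReal.ofReal_le_ofReal (le_of_eq ?_)
          have : T ^ (β - 2) = T ^ β * (T ^ 2)⁻¹ := by
            rw [Real.rpow_sub hT0, div_eq_mul_inv]; norm_num
          simp only [hc]
          rw [this, hr, div_pow, div_pow, one_pow]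
          field_simp
      _ = _ := by
          rw [← ENNReal.ofReal_tsum_of_nonneg (fun j => by positivity) hgeo.summable, hgeo.tsum_eq]
  have hnn : ∀ t, 0 ≤ m t / (T ^ 2 + t ^ 2) := fun t => div_nonneg (hm0 t) (by positivity)
  refine ⟨⟨hcont.aestronglyMeasurable, ?_⟩, ?_⟩
  · rw [hasFiniteIntegral_iff_ofReal (Filter.Eventually.of_forall hnn)]
    exact hlin.trans_lt ENNReal.ofReal_lt_top
  · rw [integral_eq_lintegral_of_nonneg_ae (Filter.Eventually.of_forall hnn)
      hcont.aestronglyMeasurable]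
    refine ENNReal.toReal_le_of_le_ofReal ?_ hlin
    have := sub_pos.mpr hr1
    positivity

/-! ### Construction of the smooth weight. -/

theorem exists_bound_of_eq_zero_off_Icc {f : ℝ → ℝ} (hf : Continuous f)
    (h0 : ∀ v ∉ Set.Icc (0 : ℝ) 1, f v = 0) : ∃ B : ℝ, 0 ≤ B ∧ ∀ v, |f v| ≤ B := by
  obtain ⟨B, hB⟩ := (isCompact_Icc (a := (0 : ℝ)) (b := 1)).exists_bound_of_continuousOn
    hf.continuousOn
  refine ⟨B, (norm_nonneg _).trans (hB 0 ⟨le_rfl, zero_le_one⟩), fun v => ?_⟩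
  by_cases hv : v ∈ Set.Icc (0 : ℝ) 1
  · exact hB v hv
  · rw [h0 v hv, abs_zero]; exact (norm_nonneg _).trans (hB 0 ⟨le_rfl, zero_le_one⟩)

theorem exists_smooth_step : ∃ (θ θ₁ θ₂ : ℝ → ℝ) (B : ℝ), 0 ≤ B ∧ ContDiff ℝ (⊤ : ℕ∞) θ ∧
    (∀ v, HasDerivAt θ (θ₁ v) v) ∧ (∀ v, HasDerivAt θ₁ (θ₂ v) v) ∧ (∀ v, 0 ≤ θ v) ∧
    (∀ v, θ v ≤ 1) ∧ (∀ v ≤ 0, θ v = 0) ∧ (∀ v, 1 ≤ v → θ v = 1) ∧ (∀ v, |θ₁ v| ≤ B) ∧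
    (∀ v, |θ₂ v| ≤ B) := by
  set θ : ℝ → ℝ := Real.smoothTransition
  have hs : ContDiff ℝ (⊤ : ℕ∞) θ := Real.smoothTransition.contDiff
  obtain ⟨hd, hs1⟩ := contDiff_infty_iff_deriv.mp hs
  obtain ⟨hd1, hs2⟩ := contDiff_infty_iff_deriv.mp hs1
  have hz : ∀ v ∉ Set.Icc (0 : ℝ) 1, deriv θ v = 0 := by
    intro v hv
    rcases not_and_or.mp hv with h | h
    · have : θ =ᶠ[nhds v] fun _ => 0 := by
        filter_upwards [eventually_lt_nhds (not_le.mp h)] with w hw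
        exact Real.smoothTransition.zero_of_nonpos hw.le
      rw [this.deriv_eq, deriv_const]
    · have : θ =ᶠ[nhds v] fun _ => 1 := by
        filter_upwards [eventually_gt_nhds (not_le.mp h)] with w hw
        exact Real.smoothTransition.one_of_one_le hw.le
      rw [this.deriv_eq, deriv_const]
  have hz2 : ∀ v ∉ Set.Icc (0 : ℝ) 1, deriv (deriv θ) v = 0 := by
    intro v hv
    have : deriv θ =ᶠ[nhds v] fun _ => 0 := by
      filter_upwards [isClosed_Icc.isOpen_compl.mem_nhds hv] with w hw using hz w hw
    rw [this.deriv_eq, deriv_const]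
  obtain ⟨B₁, h01, hB₁⟩ := exists_bound_of_eq_zero_off_Icc hs1.continuous hz
  obtain ⟨B₂, h02, hB₂⟩ := exists_bound_of_eq_zero_off_Icc hs2.continuous hz2
  exact ⟨θ, deriv θ, deriv (deriv θ), B₁ + B₂, by positivity, hs, fun v => (hd v).hasDerivAt,
    fun v => (hd1 v).hasDerivAt, Real.smoothTransition.nonneg, Real.smoothTransition.le_one,
    fun v hv => Real.smoothTransition.zero_of_nonpos hv,
    fun v hv => Real.smoothTransition.one_of_one_le hv,
    fun v => (hB₁ v).trans (by linarith), fun v => (hB₂ v).trans (by linarith)⟩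

/-- The product of a rising and a falling step of unit width. The point is that the derivative
bounds do not depend on the interval; two derivatives are controlled because the weight built below
already contains the first. -/
theorem exists_smooth_cutoff : ∃ B : ℝ, 0 ≤ B ∧ ∀ p r : ℝ, ∃ P P₁ P₂ : ℝ → ℝ,
    ContDiff ℝ (⊤ : ℕ∞) P ∧ (∀ v, HasDerivAt P (P₁ v) v) ∧ (∀ v, HasDerivAt P₁ (P₂ v) v) ∧
    (∀ v, 0 ≤ P v) ∧ (∀ v, P v ≤ 1) ∧ (∀ v ∈ Set.Icc p r, P v = 1) ∧
    (∀ v ∉ Set.Icc (p - 1) (r + 1), P v = 0) ∧ (∀ v, |P₁ v| ≤ B) ∧ (∀ v, |P₂ v| ≤ B) := by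
  obtain ⟨θ, θ₁, θ₂, B, hB, hs, hd, hd1, h0, h1, hz, ho, hb1, hb2⟩ := exists_smooth_step
  have habs : ∀ v, |θ v| ≤ 1 := fun v => abs_le.mpr ⟨by linarith [h0 v], h1 v⟩
  refine ⟨2 * B + 2 * B ^ 2, by positivity, fun p r => ?_⟩
  have hl : ∀ {g g' : ℝ → ℝ}, (∀ v, HasDerivAt g (g' v) v) → ∀ v,
      HasDerivAt (fun v => g (1 + v - p)) (g' (1 + v - p)) v := fun {g g'} hg v => by
    have h : HasDerivAt (fun v => 1 + v - p) 1 v := ((hasDerivAt_id v).const_add 1).sub_const p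
    simpa only [mul_one] using! (hg (1 + v - p)).comp v h
  have hr : ∀ {g g' : ℝ → ℝ}, (∀ v, HasDerivAt g (g' v) v) → ∀ v,
      HasDerivAt (fun v => g (1 + r - v)) (-g' (1 + r - v)) v := fun {g g'} hg v => by
    have h : HasDerivAt (fun v => 1 + r - v) (-1) v := (hasDerivAt_id v).const_sub (1 + r)
    simpa only [mul_neg, mul_one] using! (hg (1 + r - v)).comp v h
  refine ⟨fun v => θ (1 + v - p) * θ (1 + r - v),
    fun v => θ₁ (1 + v - p) * θ (1 + r - v) - θ (1 + v - p) * θ₁ (1 + r - v),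
    fun v => θ₂ (1 + v - p) * θ (1 + r - v) - 2 * (θ₁ (1 + v - p) * θ₁ (1 + r - v))
      + θ (1 + v - p) * θ₂ (1 + r - v), ?_, ?_, ?_, ?_, ?_, ?_, ?_, ?_, ?_⟩
  · exact (hs.comp (by fun_prop)).mul (hs.comp (by fun_prop))
  · intro v
    convert! (hl hd v).mul (hr hd v) using 1
    ring
  · intro v
    convert! ((hl hd1 v).mul (hr hd v)).sub ((hl hd v).mul (hr hd1 v)) using 1
    ring
  · exact fun v => mul_nonneg (h0 _) (h0 _)
  · exact fun v => mul_le_one₀ (h1 _) (h0 _) (h1 _)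
  · intro v hv
    simp only [ho (1 + v - p) (by linarith [hv.1]), ho (1 + r - v) (by linarith [hv.2]), mul_one]
  · intro v hv
    rcases not_and_or.mp hv with h | h
    · simp only [hz (1 + v - p) (by linarith [not_le.mp h]), zero_mul]
    · simp only [hz (1 + r - v) (by linarith [not_le.mp h]), mul_zero]
  · intro v
    refine (abs_sub _ _).trans ?_
    rw [abs_mul, abs_mul]
    have e1 := mul_le_mul (hb1 (1 + v - p)) (habs (1 + r - v)) (abs_nonneg _) hB
    have e2 := mul_le_mul (habs (1 + v - p)) (hb1 (1 + r - v)) (abs_nonneg _) zero_le_one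
    nlinarith
  · intro v
    refine (abs_add_le _ _).trans ((add_le_add_left (abs_sub _ _) _).trans ?_)
    rw [abs_mul, abs_mul, abs_mul, abs_mul, abs_two]
    have e1 := mul_le_mul (hb2 (1 + v - p)) (habs (1 + r - v)) (abs_nonneg _) hB
    have e2 := mul_le_mul (habs (1 + v - p)) (hb2 (1 + r - v)) (abs_nonneg _) zero_le_one
    have e3 := mul_le_mul (hb1 (1 + v - p)) (hb1 (1 + r - v)) (abs_nonneg _) hB
    nlinarith

theorem hasDerivAt_expE (γ u : ℝ) :
    HasDerivAt (fun u : ℝ => expE (γ * u)) (2 * Real.pi * Complex.I * γ * expE (γ * u)) u := by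
  unfold expE
  have h1 : HasDerivAt (fun u : ℝ => 2 * (Real.pi : ℂ) * Complex.I * ((γ * u : ℝ) : ℂ))
      (2 * Real.pi * Complex.I * γ) u := by
    have : HasDerivAt (fun u : ℝ => ((γ * u : ℝ) : ℂ)) ((γ * 1 : ℝ) : ℂ) u :=
      ((hasDerivAt_id u).const_mul γ).ofReal_comp
    simpa using this.const_mul (2 * (Real.pi : ℂ) * Complex.I)
  convert! h1.cexp using 1
  ring

theorem norm_expE (θ : ℝ) : ‖expE θ‖ = 1 := by
  rw [expE, show 2 * (Real.pi : ℂ) * Complex.I * θ = ((2 * Real.pi * θ : ℝ) : ℂ) * Complex.I by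
    push_cast; ring, Complex.norm_exp_ofReal_mul_I]

theorem expE_add (θ φ : ℝ) : expE (θ + φ) = expE θ * expE φ := by
  rw [expE, expE, expE, ← Complex.exp_add]; push_cast; ring_nf

theorem contDiff_expE (γ : ℝ) : ContDiff ℝ (⊤ : ℕ∞) fun u : ℝ => expE (γ * u) := by
  unfold expE
  exact (contDiff_const.mul (Complex.ofRealCLM.contDiff.comp (contDiff_const.mul contDiff_id))).cexp

open MeasureTheory in
/-- A smooth weight equal to `e(γu)` on `[x, x + H]`, supported in a `1 / |γ|`-neighbourhood of that
interval, and with vanishing integral. -/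
theorem exists_smooth_weight : ∃ B : ℝ, 1 ≤ B ∧ ∀ γ x H : ℝ, γ ≠ 0 → 0 < x - 1 / |γ| →
    ∃ W W' : ℝ → ℂ, IsMellinTest W (x - 1 / |γ|) (x + H + 1 / |γ|) ∧
      (∀ u, HasDerivAt W (W' u) u) ∧ (∀ u ∈ Set.Icc x (x + H), W u = expE (γ * u)) ∧
      (∀ u, ‖W u‖ ≤ B) ∧ (∀ u, ‖W' u‖ ≤ B * |γ|) ∧ mellin W 1 = 0 := by
  obtain ⟨B, hB, hcut⟩ := exists_smooth_cutoff
  -- |W| ≤ 1 + B and |W'| ≤ 2B|γ| + 2π|γ|(1 + B), with 2π ≤ 7.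
  refine ⟨9 * B + 8, by linarith, fun γ x H hγ hx => ?_⟩
  have hg : 0 < |γ| := abs_pos.mpr hγ
  set g := |γ| with hgdef
  obtain ⟨P, P₁, P₂, hs, hd, hd1, h0, h1, hone, hzero, hb1, hb2⟩ := hcut (g * x) (g * (x + H))
  -- `P` takes values in [0, 1], so its derivative vanishes wherever it equals 0 or 1. Hence the
  -- correction term in `W` disturbs neither the value e(γu) on [x, x+H] nor the support.
  have hP1 : ∀ v, P v = 1 → P₁ v = 0 := fun v hv =>
    IsLocalMax.hasDerivAt_eq_zero (Filter.Eventually.of_forall fun w => hv ▸ h1 w) (hd v)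
  have hP0 : ∀ v, P v = 0 → P₁ v = 0 := fun v hv =>
    IsLocalMin.hasDerivAt_eq_zero (Filter.Eventually.of_forall fun w => hv ▸ h0 w) (hd v)
  have hs1 : ContDiff ℝ (⊤ : ℕ∞) P₁ := by
    have := (contDiff_infty_iff_deriv.mp hs).2
    rwa [funext fun v => (hd v).deriv] at this
  set c : ℂ := 2 * Real.pi * Complex.I * γ with hc
  have hc0 : c ≠ 0 := by
    have : (Real.pi : ℂ) ≠ 0 := by exact_mod_cast Real.pi_ne_zero
    have : (γ : ℂ) ≠ 0 := by exact_mod_cast hγ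
    simp [*]
  have hcn : ‖c‖ = 2 * Real.pi * g := by
    rw [hc]; simp [hgdef, abs_of_pos Real.pi_pos]
  set κ : ℂ := g / c with hκ
  have hκn : ‖κ‖ ≤ 1 := by
    rw [hκ, norm_div, hcn, Complex.norm_real, Real.norm_of_nonneg hg.le, div_le_one (by positivity)]
    nlinarith [Real.pi_gt_three]
  have hcκ : c * κ = g := by rw [hκ]; field_simp
  -- This is the derivative of P(gu) e(γu)/c, where c = 2πiγ and κ = g/c.
  set W : ℝ → ℂ := fun u => ((P (g * u) : ℂ) + κ * (P₁ (g * u) : ℂ)) * expE (γ * u) with hW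
  set W' : ℝ → ℂ := fun u => (g * (P₁ (g * u) : ℂ) + κ * (g * (P₂ (g * u) : ℂ))) * expE (γ * u)
    + ((P (g * u) : ℂ) + κ * (P₁ (g * u) : ℂ)) * (c * expE (γ * u)) with hW'
  have hscale : ∀ {f f' : ℝ → ℝ}, (∀ v, HasDerivAt f (f' v) v) → ∀ u,
      HasDerivAt (fun u : ℝ => (f (g * u) : ℂ)) (g * (f' (g * u) : ℂ)) u := fun {f f'} hf u => by
    have h2 : HasDerivAt (fun u : ℝ => f (g * u)) (f' (g * u) * (g * 1)) u :=
      (hf (g * u)).comp u ((hasDerivAt_id u).const_mul g)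
    have := h2.ofReal_comp
    convert! this using 1
    push_cast; ring
  have hsmooth : ∀ {f : ℝ → ℝ}, ContDiff ℝ (⊤ : ℕ∞) f →
      ContDiff ℝ (⊤ : ℕ∞) fun u : ℝ => (f (g * u) : ℂ) := fun hf =>
    Complex.ofRealCLM.contDiff.comp (hf.comp (contDiff_const.mul contDiff_id))
  have hWs : ContDiff ℝ (⊤ : ℕ∞) W :=
    ((hsmooth hs).add (contDiff_const.mul (hsmooth hs1))).mul (contDiff_expE γ)
  have hout : ∀ u ∉ Set.Icc (x - 1 / g) (x + H + 1 / g), P (g * u) = 0 := by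
    intro u hu
    refine hzero _ fun hv => hu ⟨?_, ?_⟩
    · have : g * (x - 1 / g) ≤ g * u := by
        rw [mul_sub, mul_one_div_cancel hg.ne']; exact hv.1
      exact le_of_mul_le_mul_left this hg
    · have : g * u ≤ g * (x + H + 1 / g) := by
        rw [mul_add _ _ (1 / g), mul_one_div_cancel hg.ne']; exact hv.2
      exact le_of_mul_le_mul_left this hg
  have htest : IsMellinTest W (x - 1 / g) (x + H + 1 / g) :=
    ⟨hWs, hx, fun u hu => by simp [hW, hout u hu, hP0 _ (hout u hu)]⟩
  have hPn : ∀ v, ‖(P v : ℂ)‖ ≤ 1 := fun v => by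
    rw [Complex.norm_real, Real.norm_of_nonneg (h0 v)]; exact h1 v
  have hP1n : ∀ v, ‖(P₁ v : ℂ)‖ ≤ B := fun v => by rw [Complex.norm_real]; exact hb1 v
  have hP2n : ∀ v, ‖(P₂ v : ℂ)‖ ≤ B := fun v => by rw [Complex.norm_real]; exact hb2 v
  have hgn : ‖(g : ℂ)‖ = g := by rw [Complex.norm_real, Real.norm_of_nonneg hg.le]
  have hsum : ∀ u, ‖(P (g * u) : ℂ) + κ * (P₁ (g * u) : ℂ)‖ ≤ 1 + B := fun u => by
    refine (norm_add_le _ _).trans (add_le_add (hPn _) ?_)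
    rw [norm_mul]
    calc _ ≤ 1 * B := mul_le_mul hκn (hP1n _) (norm_nonneg _) zero_le_one
      _ = B := one_mul B
  refine ⟨W, W', htest, fun u => ?_, fun u hu => ?_, fun u => ?_, fun u => ?_, ?_⟩
  · exact ((hscale hd u).add ((hscale hd1 u).const_mul κ)).mul (hasDerivAt_expE γ u)
  · have : P (g * u) = 1 := hone _ ⟨by have := hu.1; gcongr, by have := hu.2; gcongr⟩
    simp [hW, this, hP1 _ this]
  · rw [hW, norm_mul, norm_expE, mul_one]
    exact (hsum u).trans (by linarith)
  · rw [hW']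
    refine (norm_add_le _ _).trans ?_
    rw [norm_mul, norm_mul, norm_mul, norm_expE, hcn]
    have e1 : ‖(g : ℂ) * (P₁ (g * u) : ℂ) + κ * (g * (P₂ (g * u) : ℂ))‖ ≤ g * B + g * B := by
      refine (norm_add_le _ _).trans (add_le_add ?_ ?_)
      · rw [norm_mul, hgn]; gcongr; exact hP1n _
      · rw [norm_mul, norm_mul, hgn]
        calc _ ≤ 1 * (g * B) := mul_le_mul hκn (by gcongr; exact hP2n _) (by positivity) zero_le_one
          _ = g * B := one_mul _
    have e2 := mul_le_mul_of_nonneg_right (hsum u) (by positivity : 0 ≤ 2 * Real.pi * g)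
    have e3 : 2 * Real.pi * g ≤ 7 * g := by
      have := Real.pi_lt_d2
      gcongr
      linarith
    have e4 := mul_le_mul_of_nonneg_left e3 (by linarith : 0 ≤ 1 + B)
    nlinarith
  -- The Mellin transform at 1 is the plain integral of `W`, which is zero because `W` has the
  -- compactly supported primitive `V`.
  · set V : ℝ → ℂ := fun u => (P (g * u) : ℂ) * expE (γ * u) / c with hV
    have hVd : ∀ u, HasDerivAt V (W u) u := fun u => by
      convert! ((hscale hd u).mul (hasDerivAt_expE γ u)).div_const c using 1
      rw [hW, ← hcκ, ← hc]
      field_simp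
      ring
    have hVc : HasCompactSupport V :=
      HasCompactSupport.intro (K := Set.Icc (x - 1 / g) (x + H + 1 / g))
        isCompact_Icc fun u hu => by simp [hV, hout u hu]
    have hWc : HasCompactSupport W := HasCompactSupport.intro isCompact_Icc htest.eq_zero
    have hint := integral_eq_zero_of_hasDerivAt_of_integrable hVd
      (hWs.continuous.integrable_of_hasCompactSupport hWc)
      ((continuous_iff_continuousAt.mpr fun u =>
        (hVd u).continuousAt).integrable_of_hasCompactSupport hVc)
    rw [mellin, ← hint, ← setIntegral_eq_integral_of_forall_compl_eq_zero (s := Set.Ioi 0) (f := W)]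
    · refine setIntegral_congr_fun measurableSet_Ioi fun u _ => by simp
    · intro u hu
      exact htest.eq_zero u fun h => hu (hx.trans_le h.1)

/-! ### Bounds for the smoothed sums. -/

open MeasureTheory in
theorem IsMellinTest.integral_weighted_le {W W' : ℝ → ℂ} {a b : ℝ} (hW : IsMellinTest W a b)
    (hab : a ≤ b) {B B' T : ℝ} (hB : ∀ u, ‖W u‖ ≤ B) (hW' : ∀ u, HasDerivAt W (W' u) u)
    (hB' : ∀ u, ‖W' u‖ ≤ B') :
    Integrable (fun t : ℝ => (T ^ 2 + t ^ 2) * ‖mellin W (1 / 2 + t * Complex.I)‖ ^ 2) ∧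
      ∫ t : ℝ, (T ^ 2 + t ^ 2) * ‖mellin W (1 / 2 + t * Complex.I)‖ ^ 2 ≤
        2 * Real.pi * (T ^ 2 * B ^ 2 + (B / 2 + b * B') ^ 2) * (b - a) := by
  simp_rw [add_mul]
  have h1 := hW.integrable_norm_sq_mellin.const_mul (T ^ 2)
  have h2 := hW.integrable_sq_mul_norm_sq_mellin
  refine ⟨h1.add h2, ?_⟩
  rw [integral_add h1 h2, integral_const_mul]
  have e1 := mul_le_mul_of_nonneg_left (hW.integral_norm_sq_mellin_le hab hB) (sq_nonneg T)
  have e2 := hW.integral_sq_mul_norm_sq_mellin_le hab hB hW' hB'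
  linarith

-- Dilating the weight by d multiplies its Mellin transform by d^(-s), of modulus d^(-1/2) on the
-- critical line. The zero at s = 1 is preserved, so a single weighted estimate serves all d.
open MeasureTheory in
theorem IsLContinuation.norm_tsum_mul_test_dilate_le {f : ArithmeticFunction ℂ} {q : ℕ}
    {χ : DirichletCharacter ℂ q} {Λ : ℂ → ℂ} (hΛ : IsLContinuation f χ Λ)
    (hsum : LSeriesSummable (fun n : ℕ => f n * χ (n : ZMod q)) 2) {W : ℝ → ℂ} {a b : ℝ}
    (hW : IsMellinTest W a b) (hW1 : mellin W 1 = 0) {w : ℝ → ℝ} (hw : ∀ t, 0 < w t) {U V : ℝ}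
    (hU : 0 < U) (hV : 0 < V)
    (hΛw : Integrable fun t : ℝ => ‖Λ (1 / 2 + t * Complex.I)‖ ^ 2 / w t)
    (hWw : Integrable fun t : ℝ => w t * ‖mellin W (1 / 2 + t * Complex.I)‖ ^ 2)
    (hΛU : ∫ t : ℝ, ‖Λ (1 / 2 + t * Complex.I)‖ ^ 2 / w t ≤ U)
    (hWV : ∫ t : ℝ, w t * ‖mellin W (1 / 2 + t * Complex.I)‖ ^ 2 ≤ V) {d : ℝ} (hd : 0 < d) :
    ‖∑' n : ℕ, f n * χ (n : ZMod q) * W (d * n)‖ ≤ d ^ (-(1 / 2) : ℝ) * (√U * √V) := by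
  have hc := hΛ.continuous_vertical (σ := 1 / 2) le_rfl (by norm_num)
  push_cast at hc
  have hm : Continuous fun t : ℝ => mellin W (1 / 2 + t * Complex.I) :=
    hW.differentiable_mellin.continuous.comp (by fun_prop)
  obtain ⟨hint, hle⟩ := integrable_mul_and_integral_le_sqrt_mul_sqrt hc.norm hm.norm
    (fun _ => norm_nonneg _) (fun _ => norm_nonneg _) hw hΛw hWw hU hV hΛU hWV
  have hscale : ∀ t : ℝ, ‖mellin (fun u => W (d * u)) (1 / 2 + t * Complex.I)‖ =
      d ^ (-(1 / 2) : ℝ) * ‖mellin W (1 / 2 + t * Complex.I)‖ := fun t => by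
    rw [mellin_comp_mul_left W _ hd, norm_smul, Complex.norm_cpow_eq_rpow_re_of_pos hd]
    simp
  have hmul : ∀ t : ℝ, ‖Λ (1 / 2 + t * Complex.I)‖ *
      ‖mellin (fun u => W (d * u)) (1 / 2 + t * Complex.I)‖ = d ^ (-(1 / 2) : ℝ) *
        (‖Λ (1 / 2 + t * Complex.I)‖ * ‖mellin W (1 / 2 + t * Complex.I)‖) := fun t => by
    rw [hscale]; ring
  refine (hΛ.norm_tsum_mul_test_le hsum (hW.comp_mul_left hd) ?_ ?_).trans ?_
  · rw [mellin_comp_mul_left W _ hd, hW1, smul_zero]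
  · simp_rw [hmul]; exact hint.const_mul _
  · simp_rw [hmul]
    rw [integral_const_mul]
    gcongr

theorem ClassF.norm_le_rpow {k : ℕ} {α : ℝ} {g : ArithmeticFunction ℂ} (hg : ClassF k α g) {δ : ℝ}
    (hδ : 0 < δ) : ∃ C : ℝ, 0 < C ∧ ∀ n : ℕ, ‖g n‖ ≤ C * (n : ℝ) ^ δ := by
  obtain ⟨C, hC, h⟩ := exists_divisorK_le_rpow k hδ
  exact ⟨C, hC, fun n => (hg.divisor_bound n).trans (h n)⟩

theorem ClassF.lseriesSummable_two {k : ℕ} {α : ℝ} {g : ArithmeticFunction ℂ} (hg : ClassF k α g)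
    {q : ℕ} (χ : DirichletCharacter ℂ q) :
    LSeriesSummable (fun n : ℕ => g n * χ (n : ZMod q)) 2 := by
  obtain ⟨C, -, h⟩ := hg.norm_le_rpow (by norm_num : (0 : ℝ) < 1 / 2)
  refine LSeriesSummable_of_le_const_mul_rpow (x := 3 / 2) (by norm_num) ⟨C, fun n _ => ?_⟩
  rw [norm_mul, show (3 / 2 - 1 : ℝ) = 1 / 2 by norm_num]
  exact (mul_le_of_le_one_right (norm_nonneg _) (χ.norm_le_one _)).trans (h n)

/-- The twisted smooth sums of a function of the class `F_k(α)` at the frequency `γ`. -/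
theorem ClassF.exists_norm_tsum_weight_le {k : ℕ} {α : ℝ} {g : ArithmeticFunction ℂ}
    (hg : ClassF k α g) (hα0 : 0 ≤ α) {ε : ℝ} (hε : 0 < ε) (hαε : α + ε ^ 2 < 1) {B : ℝ}
    (hB : 1 ≤ B) :
    ∃ C : ℝ, 0 < C ∧ ∀ (q : ℕ) (χ : DirichletCharacter ℂ q) (X x H γ d : ℝ) (W W' : ℝ → ℂ),
      0 < q → 0 < d → X ≤ x → x ≤ 2 * X → 1 ≤ H → H ≤ X → γ ≠ 0 → 2 / |γ| ≤ H →
      IsMellinTest W (x - 1 / |γ|) (x + H + 1 / |γ|) → (∀ u, HasDerivAt W (W' u) u) →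
      (∀ u, ‖W u‖ ≤ B) → (∀ u, ‖W' u‖ ≤ B * |γ|) → mellin W 1 = 0 →
      ‖∑' n : ℕ, g n * χ (n : ZMod q) * W (d * n)‖ ≤ C * d ^ (-(1 / 2) : ℝ) *
        (q : ℝ) ^ (ε ^ 2 / 2) * (|γ| * X) ^ ((1 + α + ε ^ 2) / 2) * H ^ (1 / 2 : ℝ) := by
  obtain ⟨Λ, hΛ, hmom⟩ := hg.analytic
  obtain ⟨C₀, hC₀⟩ := hmom ε hε
  set β : ℝ := 1 + α + ε ^ 2 with hβ
  obtain ⟨Cβ, hCβ, hint⟩ := exists_integral_div_sq_add_sq_le (β := β) (by positivity)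
    (by linarith)
  set C₁ : ℝ := max C₀ 1
  have hC₁ : 1 ≤ C₁ := le_max_right _ _
  refine ⟨√(Cβ * C₁ * (500 * B ^ 2)), by positivity,
    fun q χ X x H γ d W W' hq hd hx1 hx2 hH1 hHX hγ hγH hW hW' hWB hWB' hW1 => ?_⟩
  have hq0 : (0 : ℝ) < q := by exact_mod_cast hq
  have hg0 : 0 < |γ| := abs_pos.mpr hγ
  have hX0 : 0 < X := by linarith
  set T := |γ| * X with hT
  have hγinv : 1 / |γ| ≤ H / 2 := by
    have : 2 / |γ| = 2 * (1 / |γ|) := by ring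
    linarith
  have hT1 : 1 ≤ T := by
    rw [hT, mul_comm, ← div_le_iff₀ hg0]
    linarith
  have hT0 : 0 < T := by linarith
  have hγpos : 0 < 1 / |γ| := by positivity
  set M := C₁ * (q : ℝ) ^ (ε ^ 2)
  have hM : 0 < M := by positivity
  have hc := (hΛ q hq χ).continuous_vertical (σ := 1 / 2) le_rfl (by norm_num)
  push_cast at hc
  obtain ⟨hi1, hi2⟩ := hint (fun t => ‖Λ q χ (1 / 2 + t * Complex.I)‖ ^ 2) M (hc.norm.pow 2)
    (fun t => by positivity) hM.le (fun T hT => (hC₀ q hq χ T hT).trans (by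
      simp only [M]
      gcongr
      exact le_max_left _ _)) T hT1
  obtain ⟨hj1, hj2⟩ := hW.integral_weighted_le (T := T) (by linarith) hWB hW' hWB'
  -- The support ends below 4X and has length at most 2H, so with T ≥ 1 the derivative term is at
  -- most 5BT; the constant is 7 · (1 + 25) · 2 = 364.
  have hV : 2 * Real.pi * (T ^ 2 * B ^ 2 + (B / 2 + (x + H + 1 / |γ|) * (B * |γ|)) ^ 2) *
      (x + H + 1 / |γ| - (x - 1 / |γ|)) ≤ 500 * B ^ 2 * T ^ 2 * H := by
    have hb : x + H + 1 / |γ| ≤ 4 * X := by linarith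
    have h1 : (x + H + 1 / |γ|) * (B * |γ|) ≤ 4 * B * T := by
      calc _ ≤ 4 * X * (B * |γ|) := by gcongr
        _ = _ := by rw [hT]; ring
    have h2 : B / 2 + (x + H + 1 / |γ|) * (B * |γ|) ≤ 5 * B * T := by nlinarith
    have h3 : 0 ≤ B / 2 + (x + H + 1 / |γ|) * (B * |γ|) := by
      have : 0 ≤ x + H + 1 / |γ| := by linarith
      positivity
    have h4 : (B / 2 + (x + H + 1 / |γ|) * (B * |γ|)) ^ 2 ≤ (5 * B * T) ^ 2 :=
      pow_le_pow_left₀ h3 h2 2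
    have h5 : x + H + 1 / |γ| - (x - 1 / |γ|) ≤ 2 * H := by linarith
    have hpi : 2 * Real.pi ≤ 7 := by have := Real.pi_lt_d2; linarith
    calc _ ≤ 7 * (T ^ 2 * B ^ 2 + (5 * B * T) ^ 2) * (2 * H) := by
          refine mul_le_mul (mul_le_mul hpi (by gcongr) (by positivity) (by norm_num)) h5 ?_
            (by positivity)
          linarith
      _ = 364 * (B ^ 2 * T ^ 2 * H) := by ring
      _ ≤ 500 * (B ^ 2 * T ^ 2 * H) := by gcongr; norm_num
      _ = _ := by ring
  have key := (hΛ q hq χ).norm_tsum_mul_test_dilate_le (hg.lseriesSummable_two χ) hW hW1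
    (w := fun t => T ^ 2 + t ^ 2) (fun t => by positivity)
    (U := Cβ * M * T ^ (β - 2)) (V := 500 * B ^ 2 * T ^ 2 * H) (by positivity) (by positivity)
    hi1 hj1 hi2 (hj2.trans hV) hd
  refine key.trans (le_of_eq ?_)
  rw [← Real.sqrt_mul (by positivity)]
  have e1 : Cβ * M * T ^ (β - 2) * (500 * B ^ 2 * T ^ 2 * H) =
      Cβ * C₁ * (500 * B ^ 2) * ((q : ℝ) ^ (ε ^ 2) * T ^ β * H) := by
    have : T ^ (β - 2) = T ^ β / T ^ 2 := by rw [Real.rpow_sub hT0]; norm_num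
    rw [this]
    simp only [M]
    field_simp
  have hA : 0 ≤ Cβ * C₁ * (500 * B ^ 2) := by positivity
  rw [e1]
  generalize Cβ * C₁ * (500 * B ^ 2) = A at hA
  rw [Real.sqrt_mul hA, Real.sqrt_mul (by positivity), Real.sqrt_mul (by positivity),
    Real.sqrt_eq_rpow ((q : ℝ) ^ (ε ^ 2)), Real.sqrt_eq_rpow (T ^ β), Real.sqrt_eq_rpow H,
    ← Real.rpow_mul hq0.le, ← Real.rpow_mul hT0.le]
  ring_nf

theorem expE_natCast_mul_div (m a q : ℕ) [NeZero q] :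
    expE ((m : ℝ) * ((a : ℝ) / (q : ℝ))) = ZMod.stdAddChar ((m : ZMod q) * (a : ZMod q)) := by
  have := ZMod.stdAddChar_coe (N := q) ((m * a : ℕ) : ℤ)
  push_cast at this
  rw [this, expE]
  push_cast
  congr 1
  ring

theorem norm_stdAddChar {q : ℕ} [NeZero q] (b : ZMod q) : ‖(ZMod.stdAddChar b : ℂ)‖ = 1 := by
  rw [ZMod.stdAddChar_apply]
  exact Circle.norm_coe _

/-- The character coefficients depend on d and a, but their ℓ¹ norm is at most √q in every case,
with no coprimality of da and q needed. Since d and n are coprime, g(d) factors out, and the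
characters themselves enforce that n is coprime to q. -/
theorem norm_sum_coprime_le_of_twists {g : ArithmeticFunction ℂ} (hg : g.IsMultiplicative)
    {q : ℕ} (hq : 0 < q) (a N d : ℕ) (hd : d ∈ Nat.factoredNumbers q.primeFactors) (w : ℕ → ℂ)
    (hw : ∀ n, N < n → w n = 0) {E : ℝ}
    (hE : ∀ χ : DirichletCharacter ℂ q, ‖∑' n : ℕ, g n * χ (n : ZMod q) * w n‖ ≤ E) :
    ‖∑ n ∈ Finset.Icc 1 N with n.Coprime q,
        g (d * n) * expE (((d * n : ℕ) : ℝ) * ((a : ℝ) / (q : ℝ))) * w n‖ ≤ ‖g d‖ * (√q * E) := by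
  have : NeZero q := ⟨hq.ne'⟩
  obtain ⟨c, hc, hexp⟩ := exists_dirichletCharacter_expansion
    (fun b : ZMod q => (ZMod.stdAddChar ((d : ZMod q) * b * (a : ZMod q)) : ℂ))
    (fun b => (norm_stdAddChar _).le)
  have h1 : ∑ n ∈ Finset.Icc 1 N with n.Coprime q,
      g (d * n) * expE (((d * n : ℕ) : ℝ) * ((a : ℝ) / (q : ℝ))) * w n =
      g d * ∑ χ, c χ * ∑' n : ℕ, g n * χ (n : ZMod q) * w n := by
    have h2 : ∀ χ : DirichletCharacter ℂ q, ∑' n : ℕ, g n * χ (n : ZMod q) * w n =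
        ∑ n ∈ Finset.Icc 1 N with n.Coprime q, g n * χ (n : ZMod q) * w n := by
      intro χ
      refine tsum_eq_sum fun n hn => ?_
      simp only [Finset.mem_filter, Finset.mem_Icc, not_and_or, not_le] at hn
      rcases hn with (h | h) | h
      · rw [Nat.lt_one_iff.mp h]; simp
      · rw [hw n h, mul_zero]
      · rw [χ.map_nonunit fun hu => h ((ZMod.isUnit_iff_coprime n q).mp hu)]; simp
    simp_rw [h2, Finset.mul_sum]
    rw [Finset.sum_comm]
    refine Finset.sum_congr rfl fun n hn => ?_
    have hcop := (Finset.mem_filter.mp hn).2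
    rw [expE_natCast_mul_div, Nat.cast_mul, hexp n ((ZMod.isUnit_iff_coprime n q).mpr hcop),
      hg.map_mul_of_coprime (coprime_of_mem_factoredNumbers hd hcop), Finset.mul_sum,
      Finset.sum_mul]
    refine Finset.sum_congr rfl fun χ _ => by ring
  rw [h1, norm_mul]
  gcongr
  have hE0 : 0 ≤ E := (norm_nonneg _).trans (hE 1)
  calc ‖∑ χ, c χ * ∑' n : ℕ, g n * χ (n : ZMod q) * w n‖ ≤ ∑ χ, ‖c χ‖ * E :=
        (norm_sum_le _ _).trans (Finset.sum_le_sum fun χ _ => by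
          rw [norm_mul]; gcongr; exact hE χ)
    _ = (∑ χ, ‖c χ‖) * E := by rw [Finset.sum_mul]
    _ ≤ √q * E := by gcongr

/-- The smoothed exponential sum of a function of the class `F_k(α)`. -/
theorem ClassF.exists_norm_smooth_sum_le {k : ℕ} {α : ℝ} {g : ArithmeticFunction ℂ}
    (hg : ClassF k α g) (hα0 : 0 ≤ α) (hα1 : α < 1) {ε : ℝ} (hε : 0 < ε) {B : ℝ} (hB : 1 ≤ B) :
    ∃ C : ℝ, 0 < C ∧ ∀ (X x H γ : ℝ) (a q N : ℕ) (W W' : ℝ → ℂ),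
      0 < q → X ≤ x → x ≤ 2 * X → 1 ≤ H → H ≤ X → γ ≠ 0 → 2 / |γ| ≤ H →
      IsMellinTest W (x - 1 / |γ|) (x + H + 1 / |γ|) → (∀ u, HasDerivAt W (W' u) u) →
      (∀ u, ‖W u‖ ≤ B) → (∀ u, ‖W' u‖ ≤ B * |γ|) → mellin W 1 = 0 → x + H + 1 / |γ| < N →
      ‖∑ m ∈ Finset.Icc 1 N, g m * expE ((m : ℝ) * ((a : ℝ) / (q : ℝ))) * W m‖ ≤
        C * ((q : ℝ) * |γ| * X) ^ ((1 + α) / 2 + ε ^ 2) * H ^ (1 / 2 : ℝ) := by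
  -- The weighted moment converges only if 1 + α + ε² < 2; for large ε the estimate is proved with a
  -- smaller ε₀ and then weakened.
  set ε₀ : ℝ := min ε (√((1 - α) / 2)) with hε₀def
  have hε₀ : 0 < ε₀ := lt_min hε (Real.sqrt_pos.mpr (by linarith))
  have hε₀ε : ε₀ ^ 2 ≤ ε ^ 2 := pow_le_pow_left₀ hε₀.le (min_le_left _ _) 2
  have hαε : α + ε₀ ^ 2 < 1 := by
    have : ε₀ ^ 2 ≤ (1 - α) / 2 := by
      calc ε₀ ^ 2 ≤ √((1 - α) / 2) ^ 2 := pow_le_pow_left₀ hε₀.le (min_le_right _ _) 2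
        _ = _ := Real.sq_sqrt (by linarith)
    linarith
  obtain ⟨C₁, hC₁, hmain⟩ := hg.exists_norm_tsum_weight_le hα0 hε₀ hαε hB
  -- Any exponent below 1/2 would do: here g(d) d^(-1/2) ≪ d^(-1/4), which is summed over d at the
  -- cost q^(ε²/2).
  obtain ⟨C₂, hC₂, hgb⟩ := hg.norm_le_rpow (by norm_num : (0 : ℝ) < 1 / 4)
  obtain ⟨C₃, hC₃, hfac⟩ := exists_sum_factoredNumbers_rpow_le (β := 1 / 4) (δ := ε ^ 2 / 2)
    (by norm_num) (by positivity)
  refine ⟨C₁ * C₂ * C₃, by positivity,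
    fun X x H γ a q N W W' hq hx1 hx2 hH1 hHX hγ hγH hW hW' hWB hWB' hW1 hN => ?_⟩
  have hq1 : (1 : ℝ) ≤ q := by exact_mod_cast hq
  have hq0 : (0 : ℝ) < q := by linarith
  have hg0 : 0 < |γ| := abs_pos.mpr hγ
  have hT1 : 1 ≤ |γ| * X := by
    rw [mul_comm, ← div_le_iff₀ hg0]
    have : 2 / |γ| = 2 * (1 / |γ|) := by ring
    have : 0 < 1 / |γ| := by positivity
    linarith
  set T := |γ| * X with hT
  set R : ℝ := (q : ℝ) ^ (ε₀ ^ 2 / 2) * T ^ ((1 + α + ε₀ ^ 2) / 2) * H ^ (1 / 2 : ℝ) with hR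
  have hR0 : 0 < R := by positivity
  have hWN : ∀ m : ℕ, N < m → W m = 0 := fun m hm => hW.eq_zero _ fun h => by
    have : (N : ℝ) < m := by exact_mod_cast hm
    linarith [h.2]
  rw [sum_Icc_eq_sum_factored_sum_coprime hq.ne' N _ fun m hm => by rw [hWN m hm, mul_zero]]
  set D := (Finset.Icc 1 N).filter (· ∈ Nat.factoredNumbers q.primeFactors) with hD
  have hterm : ∀ d ∈ D, ‖∑ n ∈ Finset.Icc 1 N with n.Coprime q,
      g (d * n) * expE (((d * n : ℕ) : ℝ) * ((a : ℝ) / (q : ℝ))) * W ((d * n : ℕ) : ℝ)‖ ≤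
      C₁ * C₂ * √q * R * (d : ℝ) ^ (-(1 / 4) : ℝ) := by
    intro d hd
    obtain ⟨hd1, hdf⟩ := Finset.mem_filter.mp hd
    have hd1 : 1 ≤ d := (Finset.mem_Icc.mp hd1).1
    have hd0 : (0 : ℝ) < d := by exact_mod_cast hd1
    have h := norm_sum_coprime_le_of_twists hg.multiplicative hq a N d hdf
      (fun n => W ((d * n : ℕ) : ℝ))
      (fun n hn => hWN _ (hn.trans_le (Nat.le_mul_of_pos_left n hd1)))
      (E := C₁ * (d : ℝ) ^ (-(1 / 2) : ℝ) * R) (fun χ => by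
        have := hmain q χ X x H γ d W W' hq hd0 hx1 hx2 hH1 hHX hγ hγH hW hW' hWB hWB' hW1
        push_cast
        rw [hR]
        refine this.trans (le_of_eq (by ring)))
    refine h.trans ?_
    calc ‖g d‖ * (√q * (C₁ * (d : ℝ) ^ (-(1 / 2) : ℝ) * R))
        ≤ (C₂ * (d : ℝ) ^ (1 / 4 : ℝ)) * (√q * (C₁ * (d : ℝ) ^ (-(1 / 2) : ℝ) * R)) := by
          gcongr; exact hgb d
      _ = C₁ * C₂ * √q * R * ((d : ℝ) ^ (1 / 4 : ℝ) * (d : ℝ) ^ (-(1 / 2) : ℝ)) := by ring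
      _ = _ := by rw [← Real.rpow_add hd0]; norm_num
  have hTα : T ^ ((1 + α + ε₀ ^ 2) / 2) ≤ T ^ ((1 + α) / 2 + ε ^ 2) :=
    Real.rpow_le_rpow_of_exponent_le hT1 (by nlinarith [sq_nonneg ε])
  -- The three powers of q come from the character expansion, the second moment and the sum over d.
  have hqα : √q * (q : ℝ) ^ (ε₀ ^ 2 / 2) * (q : ℝ) ^ (ε ^ 2 / 2) ≤
      (q : ℝ) ^ ((1 + α) / 2 + ε ^ 2) := by
    rw [Real.sqrt_eq_rpow, ← Real.rpow_add hq0, ← Real.rpow_add hq0]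
    exact Real.rpow_le_rpow_of_exponent_le hq1 (by linarith)
  calc _ ≤ ∑ d ∈ D, C₁ * C₂ * √q * R * (d : ℝ) ^ (-(1 / 4) : ℝ) :=
        (norm_sum_le _ _).trans (Finset.sum_le_sum hterm)
    _ = C₁ * C₂ * √q * R * ∑ d ∈ D, (d : ℝ) ^ (-(1 / 4) : ℝ) := by rw [Finset.mul_sum]
    _ ≤ C₁ * C₂ * √q * R * (C₃ * (q : ℝ) ^ (ε ^ 2 / 2)) := by
        gcongr
        exact hfac q hq.ne' D fun d hd => (Finset.mem_filter.mp hd).2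
    _ = C₁ * C₂ * C₃ * ((√q * (q : ℝ) ^ (ε₀ ^ 2 / 2) * (q : ℝ) ^ (ε ^ 2 / 2)) *
          T ^ ((1 + α + ε₀ ^ 2) / 2)) * H ^ (1 / 2 : ℝ) := by rw [hR]; ring
    _ ≤ C₁ * C₂ * C₃ * ((q : ℝ) ^ ((1 + α) / 2 + ε ^ 2) * T ^ ((1 + α) / 2 + ε ^ 2)) *
          H ^ (1 / 2 : ℝ) := by gcongr
    _ = _ := by
        rw [← Real.mul_rpow hq0.le (by positivity), hT, mul_assoc (q : ℝ)]

/-! ### Return to the sharp cutoff and estimation of the edges. -/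

/-- The exponential sum of a function of the class `F_k(α)` over a short interval, up to the
contribution of neighbourhoods of size `1 / |γ|` of its end points. -/
theorem ClassF.exists_norm_shortExpSum_le {k : ℕ} {α : ℝ} {g : ArithmeticFunction ℂ}
    (hg : ClassF k α g) (hα0 : 0 ≤ α) (hα1 : α < 1) {ε : ℝ} (hε : 0 < ε) :
    ∃ C : ℝ, 0 < C ∧ ∀ (X x H γ : ℝ) (a q : ℕ),
      0 < q → X ≤ x → x ≤ 2 * X → 1 ≤ H → H ≤ X → γ ≠ 0 → 2 / |γ| ≤ H →
      ‖shortExpSum g x H ((a : ℝ) / (q : ℝ) + γ)‖ ≤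
        C * (((q : ℝ) * |γ| * X) ^ ((1 + α) / 2 + ε ^ 2) * H ^ ((1 : ℝ) / 2)
          + (divisorSum k (x - 1 / |γ|) x + divisorSum k (x + H) (x + H + 1 / |γ|))) := by
  obtain ⟨B, hB, hweight⟩ := exists_smooth_weight
  obtain ⟨C, hC, hsmooth⟩ := hg.exists_norm_smooth_sum_le hα0 hα1 hε hB
  refine ⟨C + B, by linarith, fun X x H γ a q hq hx1 hx2 hH1 hHX hγ hγH => ?_⟩
  have hg0 : 0 < |γ| := abs_pos.mpr hγ
  have hγpos : 0 < 1 / |γ| := by positivity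
  have hγinv : 1 / |γ| ≤ H / 2 := by
    have : 2 / |γ| = 2 * (1 / |γ|) := by ring
    linarith
  obtain ⟨W, W', hW, hW', hWe, hWB, hWB', hW1⟩ := hweight γ x H hγ (by linarith)
  set N : ℕ := ⌊x + H + 1 / |γ|⌋₊ + 1 with hN
  have hNlt : x + H + 1 / |γ| < N := by rw [hN]; push_cast; exact Nat.lt_floor_add_one _
  have hS := hsmooth X x H γ a q N W W' hq hx1 hx2 hH1 hHX hγ hγH hW hW' hWB hWB' hW1 hNlt
  set h : ℕ → ℂ := fun m => g m * expE ((m : ℝ) * ((a : ℝ) / (q : ℝ))) * W m with hh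
  set I := Finset.Icc ⌈x⌉₊ ⌊x + H⌋₊ with hI
  have hsub : I ⊆ Finset.Icc 1 N := by
    refine Finset.Icc_subset_Icc (Nat.one_le_ceil_iff.mpr (by linarith)) ?_
    exact (Nat.floor_le_floor (by linarith)).trans (Nat.le_succ _)
  have hshort : shortExpSum g x H ((a : ℝ) / (q : ℝ) + γ) = ∑ m ∈ I, h m := by
    refine Finset.sum_congr rfl fun m hm => ?_
    have hm' := Finset.mem_Icc.mp hm
    have h1 : x ≤ m := Nat.ceil_le.mp hm'.1
    have h2 : (m : ℝ) ≤ x + H := (Nat.le_floor_iff (by linarith)).mp hm'.2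
    rw [hh]
    simp only
    rw [hWe m ⟨h1, h2⟩, mul_add, expE_add, mul_comm (m : ℝ) γ, mul_assoc]
  set E₁ := Finset.Icc ⌈x - 1 / |γ|⌉₊ ⌊x⌋₊ with hE₁
  set E₂ := Finset.Icc ⌈x + H⌉₊ ⌊x + H + 1 / |γ|⌋₊ with hE₂
  have hedge : ‖∑ m ∈ Finset.Icc 1 N \ I, h m‖ ≤
      B * (divisorSum k (x - 1 / |γ|) x + divisorSum k (x + H) (x + H + 1 / |γ|)) := by
    have hb : ∀ m, ‖h m‖ ≤ B * (divisorK k m : ℝ) := fun m => by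
      rw [hh]
      simp only [norm_mul, norm_expE, mul_one]
      rw [mul_comm B]
      exact mul_le_mul (hg.divisor_bound m) (hWB _) (norm_nonneg _) (by positivity)
    have hz : ∑ m ∈ (Finset.Icc 1 N \ I).filter (fun m => h m ≠ 0), h m =
        ∑ m ∈ Finset.Icc 1 N \ I, h m := Finset.sum_filter_ne_zero _
    rw [← hz]
    -- Outside [x, x+H] the weight lives only within 1/|γ| of the end points, so just two edges
    -- survive.
    have hsub2 : (Finset.Icc 1 N \ I).filter (fun m => h m ≠ 0) ⊆ E₁ ∪ E₂ := by
      intro m hm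
      obtain ⟨hm1, hm2⟩ := Finset.mem_filter.mp hm
      have hmI := (Finset.mem_sdiff.mp hm1).2
      have hmem : (m : ℝ) ∈ Set.Icc (x - 1 / |γ|) (x + H + 1 / |γ|) := by
        by_contra hc
        exact hm2 (by rw [hh]; simp only; rw [hW.eq_zero _ hc, mul_zero])
      simp only [hI, Finset.mem_Icc, not_and_or, not_le] at hmI
      rw [Finset.mem_union]
      rcases hmI with hlt | hlt
      · left
        exact Finset.mem_Icc.mpr ⟨Nat.ceil_le.mpr hmem.1,
          (Nat.le_floor_iff (by linarith)).mpr (Nat.lt_ceil.mp hlt).le⟩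
      · right
        exact Finset.mem_Icc.mpr ⟨Nat.ceil_le.mpr ((Nat.floor_lt (by linarith)).mp hlt).le,
          (Nat.le_floor_iff (by linarith)).mpr hmem.2⟩
    calc _ ≤ ∑ m ∈ (Finset.Icc 1 N \ I).filter (fun m => h m ≠ 0), B * (divisorK k m : ℝ) :=
          (norm_sum_le _ _).trans (Finset.sum_le_sum fun m _ => hb m)
      _ ≤ ∑ m ∈ E₁ ∪ E₂, B * (divisorK k m : ℝ) :=
          Finset.sum_le_sum_of_subset_of_nonneg hsub2 fun m _ _ => by positivity
      _ ≤ ∑ m ∈ E₁, B * (divisorK k m : ℝ) + ∑ m ∈ E₂, B * (divisorK k m : ℝ) := by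
          rw [← Finset.sum_union_inter]
          exact le_add_of_nonneg_right (Finset.sum_nonneg fun m _ => by positivity)
      _ = _ := by rw [← Finset.mul_sum, ← Finset.mul_sum, ← mul_add]; rfl
  have hdiv : 0 ≤ divisorSum k (x - 1 / |γ|) x + divisorSum k (x + H) (x + H + 1 / |γ|) :=
    add_nonneg (Finset.sum_nonneg fun _ _ => by positivity)
      (Finset.sum_nonneg fun _ _ => by positivity)
  set Y := divisorSum k (x - 1 / |γ|) x + divisorSum k (x + H) (x + H + 1 / |γ|)
  set Z := ((q : ℝ) * |γ| * X) ^ ((1 + α) / 2 + ε ^ 2) * H ^ ((1 : ℝ) / 2) with hZ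
  have hZ0 : 0 ≤ Z := by
    have : 0 ≤ X := by linarith
    positivity
  have hsplit : ∑ m ∈ I, h m = ∑ m ∈ Finset.Icc 1 N, h m - ∑ m ∈ Finset.Icc 1 N \ I, h m := by
    rw [← Finset.sum_sdiff hsub]; ring
  rw [hshort, hsplit]
  calc _ ≤ C * Z + B * Y := (norm_sub_le _ _).trans (add_le_add (hS.trans (by
          rw [hZ, mul_assoc])) hedge)
    _ ≤ (C + B) * (Z + Y) := by nlinarith [mul_nonneg hC.le hdiv, mul_nonneg (by linarith : 0 ≤ B) hZ0]

theorem divisorSum_mono (k : ℕ) {u u' v v' : ℝ} (hu : u' ≤ u) (hv : v ≤ v') :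
    divisorSum k u v ≤ divisorSum k u' v' :=
  Finset.sum_le_sum_of_subset_of_nonneg
    (Finset.Icc_subset_Icc (Nat.ceil_le_ceil hu) (Nat.floor_le_floor hv))
    fun _ _ _ => by positivity

theorem divisorSum_le_of_forall_le {k : ℕ} {u v D : ℝ} (hu : 0 ≤ u) (huv : u ≤ v) (hD0 : 0 ≤ D)
    (hD : ∀ m : ℕ, (m : ℝ) ≤ v → (divisorK k m : ℝ) ≤ D) :
    divisorSum k u v ≤ (v - u + 1) * D := by
  have hcard : ((Finset.Icc ⌈u⌉₊ ⌊v⌋₊).card : ℝ) ≤ v - u + 1 := by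
    rw [Nat.card_Icc]
    have h1 : u ≤ ⌈u⌉₊ := Nat.le_ceil u
    have h2 : (⌊v⌋₊ : ℝ) ≤ v := Nat.floor_le (hu.trans huv)
    rcases le_total ⌈u⌉₊ (⌊v⌋₊ + 1) with h | h
    · rw [Nat.cast_sub h]; push_cast; linarith
    · rw [Nat.sub_eq_zero_of_le h]; push_cast; linarith
  calc divisorSum k u v ≤ ∑ m ∈ Finset.Icc ⌈u⌉₊ ⌊v⌋₊, D :=
        Finset.sum_le_sum fun m hm => hD m
          ((Nat.le_floor_iff (hu.trans huv)).mp (Finset.mem_Icc.mp hm).2)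
    _ = (Finset.Icc ⌈u⌉₊ ⌊v⌋₊).card * D := by rw [Finset.sum_const, nsmul_eq_mul]
    _ ≤ _ := by gcongr

/-- The choice K = 2 makes the smoothing scale 1/|γ| at most half of H^(η-ε/2), hence at most H/2
and H^η/2. -/
theorem frequency_bounds {ε η H γ : ℝ} (hε : 0 < ε) (hη1 : η < 1) (hH1 : 1 ≤ H) (hγ1 : |γ| < 1)
    (hK : 2 ≤ |γ| * H ^ (η - ε / 2)) :
    γ ≠ 0 ∧ 2 / |γ| ≤ H ^ (η - ε / 2) ∧ H ^ (η - ε / 2) ≤ H ∧ H ^ (η - ε / 2) ≤ H ^ η := by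
  have hγ : γ ≠ 0 := by
    rintro rfl
    rw [abs_zero, zero_mul] at hK
    linarith
  have hg0 : 0 < |γ| := abs_pos.mpr hγ
  refine ⟨hγ, (div_le_iff₀' hg0).mpr hK, ?_,
    Real.rpow_le_rpow_of_exponent_le hH1 (by linarith)⟩
  calc H ^ (η - ε / 2) ≤ H ^ (1 : ℝ) := Real.rpow_le_rpow_of_exponent_le hH1 (by linarith)
    _ = H := Real.rpow_one H

/-- This lets the pointwise divisor bound replace a mean value of d_k over short intervals. If H <
X^(1/3), the left side is at most X^(1/3+1/6) = X^(1/2), and |γ|H ≥ 1 puts this below the first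
term. If H ≥ X^(1/3), then X^δ ≤ X^(ε/6) ≤ H^(ε/2). The logarithm is used only through log X ≥ 1,
for X ≥ 3; the range X < 3 is trivial and accounts for the constant 9 = 3 · 3. -/
theorem exists_rpow_edge_le {ε : ℝ} (hε : 0 < ε) : ∃ δ : ℝ, 0 < δ ∧ δ ≤ 1 ∧
    ∀ (k : ℕ) (η X H γ q : ℝ), η < 1 → 1 ≤ q → 1 ≤ H → H ≤ X → |γ| < 1 →
      2 ≤ |γ| * H ^ (η - ε / 2) →
      H ^ (η - ε / 2) * X ^ δ ≤ 9 * ((q * |γ| * X) ^ ((1 : ℝ) / 2 + ε ^ 2) * H ^ ((1 : ℝ) / 2)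
        + H ^ η * Real.log X ^ k) := by
  refine ⟨min (ε / 6) (1 / 6), by positivity, (min_le_right _ _).trans (by norm_num),
    fun k η X H γ q hη1 hq1 hH1 hHX hγ1 hK => ?_⟩
  set δ := min (ε / 6) (1 / 6 : ℝ)
  have hδ0 : 0 < δ := by positivity
  have hδε : δ ≤ ε / 6 := min_le_left _ _
  have hδ6 : δ ≤ 1 / 6 := min_le_right _ _
  obtain ⟨hγ, h2γ, hHH, -⟩ := frequency_bounds hε hη1 hH1 hγ1 hK
  have hg0 : 0 < |γ| := abs_pos.mpr hγ
  have hX1 : 1 ≤ X := hH1.trans hHX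
  have hX0 : 0 < X := by linarith
  have hH0 : 0 < H := by linarith
  have hγH : 1 ≤ |γ| * H := by
    have := mul_le_mul_of_nonneg_left hHH hg0.le
    linarith
  have hqT : |γ| * X ≤ q * |γ| * X := by
    rw [mul_assoc]; exact le_mul_of_one_le_left (by positivity) hq1
  have hT1 : 1 ≤ |γ| * X := hγH.trans (by gcongr)
  have hfirst : X ^ (1 / 2 : ℝ) ≤ (q * |γ| * X) ^ ((1 : ℝ) / 2 + ε ^ 2) * H ^ ((1 : ℝ) / 2) := by
    calc X ^ (1 / 2 : ℝ) ≤ (|γ| * X * H) ^ (1 / 2 : ℝ) := by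
          refine Real.rpow_le_rpow hX0.le ?_ (by norm_num)
          nlinarith
      _ = (|γ| * X) ^ (1 / 2 : ℝ) * H ^ (1 / 2 : ℝ) := Real.mul_rpow (by positivity) hH0.le
      _ ≤ (q * |γ| * X) ^ (1 / 2 : ℝ) * H ^ (1 / 2 : ℝ) := by gcongr
      _ ≤ _ := by
          gcongr
          · exact hT1.trans hqT
          · nlinarith [sq_nonneg ε]
  have hlog0 : 0 ≤ Real.log X := Real.log_nonneg hX1
  have hfirst1 : 1 ≤ (q * |γ| * X) ^ ((1 : ℝ) / 2 + ε ^ 2) * H ^ ((1 : ℝ) / 2) :=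
    (Real.one_le_rpow hX1 (by norm_num)).trans hfirst
  have hsecond0 : 0 ≤ H ^ η * Real.log X ^ k := by positivity
  rcases lt_or_ge H (X ^ (1 / 3 : ℝ)) with hsmall | hlarge
  · calc H ^ (η - ε / 2) * X ^ δ ≤ X ^ (1 / 3 : ℝ) * X ^ (1 / 6 : ℝ) := by
          gcongr
          exact hHH.trans hsmall.le
      _ = X ^ (1 / 2 : ℝ) := by rw [← Real.rpow_add hX0]; norm_num
      _ ≤ _ := by linarith
  · rcases lt_or_ge X 3 with hX3 | hX3
    · have h1 : X ^ δ ≤ X ^ (1 : ℝ) := Real.rpow_le_rpow_of_exponent_le hX1 (by linarith)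
      rw [Real.rpow_one] at h1
      calc H ^ (η - ε / 2) * X ^ δ ≤ 3 * 3 := by
            gcongr
            · linarith
            · linarith
        _ ≤ _ := by linarith
    · have hlog1 : 1 ≤ Real.log X := by
        rw [Real.le_log_iff_exp_le hX0]
        linarith [Real.exp_one_lt_d9]
      have h1 : X ^ (ε / 6) ≤ H ^ (ε / 2) := by
        calc X ^ (ε / 6) = (X ^ (1 / 3 : ℝ)) ^ (ε / 2) := by
              rw [← Real.rpow_mul hX0.le]; ring_nf
          _ ≤ _ := Real.rpow_le_rpow (by positivity) hlarge (by positivity)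
      calc H ^ (η - ε / 2) * X ^ δ ≤ H ^ (η - ε / 2) * H ^ (ε / 2) := by
            gcongr
            exact (Real.rpow_le_rpow_of_exponent_le hX1 hδε).trans h1
        _ = H ^ η := by rw [← Real.rpow_add hH0]; ring_nf
        _ ≤ H ^ η * Real.log X ^ k := le_mul_of_one_le_right (by positivity) (one_le_pow₀ hlog1)
        _ ≤ _ := by linarith

theorem mainTheorem1 (k : ℕ) (hk : 1 ≤ k) (g : ArithmeticFunction ℂ) (ε : ℝ) (hε : 0 < ε) :
    (∀ α : ℝ, 0 ≤ α → α < 1 → ClassF k α g →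
      ∃ C K : ℝ, 0 < C ∧ 0 < K ∧
        ∀ (η X x H γ : ℝ) (a q : ℕ), 0 < η → η < 1 → a < q → (q : ℝ) < X →
          X ≤ x → x ≤ 2 * X → 1 ≤ H → H ≤ X → |γ| < 1 → K ≤ |γ| * H ^ (η - ε / 2) →
          ‖shortExpSum g x H ((a : ℝ) / (q : ℝ) + γ)‖ ≤
            C * (((q : ℝ) * |γ| * X) ^ ((1 + α) / 2 + ε ^ 2) * H ^ ((1 : ℝ) / 2)
              + (divisorSum k (x - H ^ η) x + divisorSum k (x + H) (x + H + H ^ η)))) ∧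
    (ClassF k 0 g →
      ∃ C K : ℝ, 0 < C ∧ 0 < K ∧
        ∀ (η X x H γ : ℝ) (a q : ℕ), 0 < η → η < 1 → a < q → (q : ℝ) < X →
          X ≤ x → x ≤ 2 * X → 1 ≤ H → H ≤ X → |γ| < 1 → K ≤ |γ| * H ^ (η - ε / 2) →
          ‖shortExpSum g x H ((a : ℝ) / (q : ℝ) + γ)‖ ≤
            C * (((q : ℝ) * |γ| * X) ^ ((1 : ℝ) / 2 + ε ^ 2) * H ^ ((1 : ℝ) / 2)
              + H ^ η * Real.log X ^ (k ^ 2 - 1))) := by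
  refine ⟨fun α hα0 hα1 hg => ?_, fun hg => ?_⟩
  · obtain ⟨C, hC, hmain⟩ := hg.exists_norm_shortExpSum_le hα0 hα1 hε
    refine ⟨C, 2, hC, two_pos, fun η X x H γ a q _ hη1 haq _ hx1 hx2 hH1 hHX hγ1 hK => ?_⟩
    obtain ⟨hγ, h2γ, hHH, hHη⟩ := frequency_bounds hε hη1 hH1 hγ1 hK
    have hγpos : 0 < 1 / |γ| := by have := abs_pos.mpr hγ; positivity
    have hγη : 1 / |γ| ≤ H ^ η := by
      have : 2 / |γ| = 2 * (1 / |γ|) := by ring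
      linarith
    refine (hmain X x H γ a q (by lia) hx1 hx2 hH1 hHX hγ (h2γ.trans hHH)).trans ?_
    have h1 := divisorSum_mono k (sub_le_sub_left hγη x) (le_refl x)
    have h2 := divisorSum_mono k (le_refl (x + H)) (add_le_add_right hγη (x + H))
    gcongr
  · obtain ⟨C, hC, hmain⟩ := hg.exists_norm_shortExpSum_le le_rfl zero_lt_one hε
    obtain ⟨δ, hδ0, hδ1, hedge⟩ := exists_rpow_edge_le hε
    obtain ⟨D, hD, hdiv⟩ := exists_divisorK_le_rpow k hδ0
    -- Here 72 = 8 · 9: two edges, each at most 4D H^(η-ε/2) X^δ, times the constant of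
    -- `exists_rpow_edge_le`.
    refine ⟨C * (1 + 72 * D), 2, by positivity, two_pos,
      fun η X x H γ a q _ hη1 haq _ hx1 hx2 hH1 hHX hγ1 hK => ?_⟩
    obtain ⟨hγ, h2γ, hHH, -⟩ := frequency_bounds hε hη1 hH1 hγ1 hK
    have hg0 := abs_pos.mpr hγ
    have hγ1' : 1 < 1 / |γ| := (one_lt_div hg0).mpr hγ1
    have h2γ' : 2 / |γ| = 2 * (1 / |γ|) := by ring
    have hX0 : 0 < X := by linarith
    have hq1 : (1 : ℝ) ≤ q := by exact_mod_cast (by lia : 1 ≤ q)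
    have he := hedge (k ^ 2 - 1) η X H γ q hη1 hq1 hH1 hHX hγ1 hK
    have hm := hmain X x H γ a q (by lia) hx1 hx2 hH1 hHX hγ (h2γ.trans hHH)
    have hDX : ∀ m : ℕ, (m : ℝ) ≤ 4 * X → (divisorK k m : ℝ) ≤ 4 * D * X ^ δ := fun m hm4 => by
      calc (divisorK k m : ℝ) ≤ D * (m : ℝ) ^ δ := hdiv m
        _ ≤ D * (4 * X) ^ δ := by gcongr
        _ = D * (4 ^ δ * X ^ δ) := by rw [Real.mul_rpow (by norm_num) hX0.le]
        _ ≤ D * (4 ^ (1 : ℝ) * X ^ δ) := by gcongr; norm_num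
        _ = 4 * D * X ^ δ := by rw [Real.rpow_one]; ring
    have hd1 := divisorSum_le_of_forall_le (k := k) (u := x - 1 / |γ|) (v := x)
      (by linarith) (by linarith) (by positivity) fun m hm => hDX m (by linarith)
    have hd2 := divisorSum_le_of_forall_le (k := k) (u := x + H) (v := x + H + 1 / |γ|)
      (by linarith) (by linarith) (by positivity) fun m hm => hDX m (by linarith)
    have hsum : divisorSum k (x - 1 / |γ|) x + divisorSum k (x + H) (x + H + 1 / |γ|) ≤
        8 * D * (H ^ (η - ε / 2) * X ^ δ) := by
      -- An edge contains at most 1/|γ| + 1 integers; since |γ| < 1 this is at most 2/|γ|.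
      have h1 : (1 / |γ| + 1) * (4 * D * X ^ δ) ≤ H ^ (η - ε / 2) * (4 * D * X ^ δ) := by
        gcongr; linarith
      have e1 : x - (x - 1 / |γ|) + 1 = 1 / |γ| + 1 := by ring
      have e2 : x + H + 1 / |γ| - (x + H) + 1 = 1 / |γ| + 1 := by ring
      rw [e1] at hd1
      rw [e2] at hd2
      linarith
    rw [add_zero] at hm
    have hlog : 0 ≤ Real.log X := Real.log_nonneg (hH1.trans hHX)
    set Z := ((q : ℝ) * |γ| * X) ^ ((1 : ℝ) / 2 + ε ^ 2) * H ^ ((1 : ℝ) / 2)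
    set Y := H ^ η * Real.log X ^ (k ^ 2 - 1)
    have hY : 0 ≤ Y := by positivity
    refine hm.trans ?_
    rw [mul_assoc]
    refine mul_le_mul_of_nonneg_left ?_ hC.le
    have := mul_le_mul_of_nonneg_left he (by positivity : 0 ≤ 8 * D)
    linarith
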